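/- Let $d\ge 1$. Define the Fourier basis of $L_2([0,1]^d)$ by $\varphi_{\mathbf j}(x)=\prod_{m=1}^d\varphi_{j_m}(x_m)$, $\mathbf j\in(\mathbb N^*)^d$, where $\varphi_1=1$, $\varphi_{2k}(t)=\sqrt2\cos(2\pi kt)$, $\varphi_{2k+1}(t)=\sqrt2\sin(2\pi kt)$ for $k\ge1$, and put $\theta_{\mathbf j}(f)=\int_{[0,1]^d} f\varphi_{\mathbf j}$. For $\boldsymbol\beta=(\beta_1,\dots,\beta_d)\in(0,\infty)^d$ and $R>0$ define the anisotropic Sobolev ball $$\mathcal W^{\boldsymbol\beta}(R)=\Big\{f\in L_2([0,1]^d):\ \sum_{\mathbf j\in(\mathbb N^*)^d}\big(j_1^{2\beta_1}+\dots+j_d^{2\beta_d}\big)\theta_{\mathbf j}(f)^2\le R^2\Big\}.$$ For a class $\mathcal G$ of functions on $[0,1]^d$ let $d_{\mathcal G}(f_1,f_2)=\sup_{g\in\mathcal G}\int_{[0,1]^d}(f_1-f_2)g$ (understood as $+\infty$ if one of these integrands is not integrable). Let $X_1,\dots,X_n$ be i.i.d. with density $f$ on $[0,1]^d$ (with respect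 to Lebesgue measure), and let $\mathcal Z$ be a measurable space. A mechanism $Q=(Q_1,\dots,Q_n)$ is a sequence of channels (Markov kernels) that successively generate private views $Z_i\sim Q_i(\cdot\mid X_i=x_i,Z_1=z_1,\dots,Z_{i-1}=z_{i-1})$ in $\mathcal Z$. For $\alpha>0$ let $\mathcal Q_\alpha$ be the set of $\alpha$-locally differentially private mechanisms, i.e. those with $Q_i(B\mid x,z_1,\dots,z_{i-1})\le e^\alpha Q_i(B\mid x',z_1,\dots,z_{i-1})$ for all $1\le i\le n$, all $x,x'\in[0,1]^d$, all $z_1,\dots,z_{i-1}\in\mathcal Z$ and all measurable $B\subseteq\mathcal Z$. The minimax rate is $$\rho_n(\mathcal F,\mathcal G,\mathcal Q_\alpha)=\inf_{Q\in\mathcal Q_\alpha}\ \inf_{\tilde f}\ \sup_{f\in\mathcal F,\ f\text{ a density}}\mathbb E\big[d_{\mathcal G}(\tilde f,f)\big],$$ where $\tilde f$ ranges over all estimators of $f$ based on $(Z_1,\dots,Z_n)$. Let $\boldsymbol\beta,\boldsymbol\delta\in(\mathbb N^*)^d$ be vectors of positive integers, let $\beta,\delta$ be their harmonic means, $\frac1\beta=\frac1d\sum_{m=1}^d\frac1{\beta_m}$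 and $\frac1\delta=\frac1d\sum_{m=1}^d\frac1{\delta_m}$, and assume that $\boldsymbol\beta$ and $\boldsymbol\delta$ have the same anisotropy: $\beta/\beta_m=\delta/\delta_m$ for all $1\le m\le d$. Let $R>0$ with $R^2>d$ and let $A>0$. Then there is a constant $c>0$ depending only on $\boldsymbol\beta,\boldsymbol\delta,R,d,A$ such that for every sample size $n$, every $\alpha\in(0,A]$ with $n\alpha^2\ge1$, and every measurable space $\mathcal Z$ of private views, $$\rho_n\big(\mathcal W^{\boldsymbol\beta}(R),\mathcal W^{\boldsymbol\delta}(1),\mathcal Q_\alpha\big)\ \ge\ c\,\max\Big\{(n\alpha^2)^{-\frac{\beta+\delta}{2\beta+2d}},\ (n\alpha^2)^{-1/2}\Big\}.$$ -/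

import Mathlib

open MeasureTheory ProbabilityTheory
open scoped ENNReal

namespace PrivateDensity

/-- The cube `[0,1]^d`. Its canonical measure `volume` is the product of the Lebesgue measures on
`[0,1]`, that is the Lebesgue measure of the cube. -/
abbrev Cube (d : ℕ) : Type := Fin d → unitInterval

/-! ### Fourier basis and Sobolev balls -/

/-- The one-dimensional Fourier basis, indexed by the positive integers: `φ₁ = 1`,
`φ_{2k}(t) = √2 cos (2πkt)` and `φ_{2k+1}(t) = √2 sin (2πkt)` for `k ≥ 1`
(`j / 2` is the integer quotient, so it is `k` both for `j = 2k` and for `j = 2k+1`). -/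
noncomputable def fourierOne (j : ℕ+) (t : ℝ) : ℝ :=
  if j = 1 then 1
  else if Even (j : ℕ) then Real.sqrt 2 * Real.cos (2 * Real.pi * ((j : ℕ) / 2 : ℕ) * t)
  else Real.sqrt 2 * Real.sin (2 * Real.pi * ((j : ℕ) / 2 : ℕ) * t)

/-- The `d`-dimensional Fourier basis (tensor products of the one-dimensional one). -/
noncomputable def fourierBasis {d : ℕ} (j : Fin d → ℕ+) (x : Cube d) : ℝ :=
  ∏ m, fourierOne (j m) (x m : ℝ)

/-- The Fourier coefficient `θ_j(f) = ∫_{[0,1]^d} f φ_j`. -/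
noncomputable def fourierCoeff {d : ℕ} (j : Fin d → ℕ+) (f : Cube d → ℝ) : ℝ :=
  ∫ x, f x * fourierBasis j x

/-- The anisotropic Sobolev ball `W^β(R)`: the functions `f` in `L²([0,1]^d)` with
`∑_j (j_1^{2β_1} + ⋯ + j_d^{2β_d}) θ_j(f)² ≤ R²`. -/
def sobolevBall {d : ℕ} (β : Fin d → ℝ) (R : ℝ) : Set (Cube d → ℝ) :=
  {f | MemLp f 2 volume ∧
    ∑' j : Fin d → ℕ+,
      ENNReal.ofReal ((∑ m, (((j m : ℕ) : ℝ) ^ (2 * β m))) * fourierCoeff j f ^ 2)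
        ≤ ENNReal.ofReal (R ^ 2)}

/-- The harmonic mean of `β_1, …, β_d`: `1/β = (1/d) ∑_m 1/β_m`. -/
noncomputable def harmonicMean {d : ℕ} (β : Fin d → ℝ) : ℝ :=
  1 / ((1 / (d : ℝ)) * ∑ m, 1 / β m)

/-- `β` and `δ` have the same anisotropy: `β/β_m = δ/δ_m` for all `m`, where `β`, `δ` in the
numerators are the harmonic means. -/
def SameAnisotropy {d : ℕ} (β δ : Fin d → ℝ) : Prop :=
  ∀ m, harmonicMean β / β m = harmonicMean δ / δ m

/-! ### Adversarial loss -/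

open Classical in
/-- The adversarial loss `d_G(f₁, f₂) = sup_{g ∈ G} ∫ (f₁ - f₂) g`. If `(f₁ - f₂) g` fails to be
integrable for some `g ∈ G`, the loss is `+∞`; for `f₁, f₂ ∈ L²` and `G ⊆ L²` this never
happens. -/
noncomputable def adversarialLoss {d : ℕ} (G : Set (Cube d → ℝ)) (f₁ f₂ : Cube d → ℝ) : EReal :=
  ⨆ g ∈ G,
    if Integrable (fun x => (f₁ x - f₂ x) * g x) volume
    then ((∫ x, (f₁ x - f₂ x) * g x : ℝ) : EReal)
    else ⊤

/-! ### Densities, privacy mechanisms and the law of the privatized sample -/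

/-- `f` is a probability density on the cube with respect to the Lebesgue measure. -/
structure IsDensity {d : ℕ} (f : Cube d → ℝ) : Prop where
  integrable : Integrable f volume
  nonneg : 0 ≤ᵐ[volume] f
  integral_eq_one : ∫ x, f x = 1

/-- The distribution with density `f`. -/
noncomputable def densityLaw {d : ℕ} (f : Cube d → ℝ) : Measure (Cube d) :=
  volume.withDensity (fun x => ENNReal.ofReal (f x))

/-- A (sequentially interactive) mechanism for `n` individuals: the channel of individual `i` is a
Markov kernel that takes the datum `x_i` and the earlier private views `z_k`, `k < i`, to the
distribution of the private view `Z_i`. Individuals are numbered from `0` to `n - 1`. -/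
structure Mechanism (X Z : Type*) [MeasurableSpace X] [MeasurableSpace Z] (n : ℕ) where
  channel : (i : Fin n) → Kernel (X × (Fin (i : ℕ) → Z)) Z
  markov : ∀ i, IsMarkovKernel (channel i)

/-- The `α`-locally differentially private mechanisms:
`Q_i(B | x, z_1, …, z_{i-1}) ≤ e^α Q_i(B | x', z_1, …, z_{i-1})` for all `i`, `x`, `x'`,
`z_1, …, z_{i-1}` and all measurable `B`. -/
def ldpMechanisms (X Z : Type*) [MeasurableSpace X] [MeasurableSpace Z] (n : ℕ) (α : ℝ) :
    Set (Mechanism X Z n) :=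
  {Q | ∀ (i : Fin n) (z : Fin (i : ℕ) → Z) (x x' : X) (B : Set Z), MeasurableSet B →
    Q.channel i (x, z) B ≤ ENNReal.ofReal (Real.exp α) * Q.channel i (x', z) B}

/-- The mechanism for the first `n` individuals among `n + 1`. -/
def Mechanism.init {X Z : Type*} [MeasurableSpace X] [MeasurableSpace Z] {n : ℕ}
    (Q : Mechanism X Z (n + 1)) : Mechanism X Z n where
  channel i := Q.channel i.castSucc
  markov i := Q.markov i.castSucc

/-- The law of `(Z_1, …, Z_n)` when `X_1, …, X_n` are i.i.d. with distribution `P` and are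
privatized by `Q`: the new datum `X_{n+1} ~ P` is drawn independently of the earlier views
`(Z_1, …, Z_n)`, and then `Z_{n+1} ~ Q_{n+1}(· | X_{n+1}, Z_1, …, Z_n)` is appended to them. -/
noncomputable def privateLaw {X Z : Type*} [MeasurableSpace X] [MeasurableSpace Z]
    (P : Measure X) : {n : ℕ} → Mechanism X Z n → Measure (Fin n → Z)
  | 0, _ => Measure.dirac Fin.elim0
  | n + 1, Q =>
      ((P.prod (privateLaw P Q.init)) ⊗ₘ (Q.channel (Fin.last n))).map
        (fun p : (X × (Fin n → Z)) × Z => (Fin.snoc p.1.2 p.2 : Fin (n + 1) → Z))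

/-- The minimax rate `inf_{Q ∈ 𝒬} inf_{f̃} sup_f E[d_G(f̃, f)]`. Here `f̃` runs over all estimators
based on the privatized sample, that is all (jointly measurable) maps that send
`(z_1, …, z_n)` to a function on the cube, and `f` runs over the densities in `F`. -/
noncomputable def minimaxRate {d n : ℕ} {Z : Type*} [MeasurableSpace Z]
    (F G : Set (Cube d → ℝ)) (𝒬 : Set (Mechanism (Cube d) Z n)) : ℝ≥0∞ :=
  ⨅ Q ∈ 𝒬,
    ⨅ (fhat : (Fin n → Z) → Cube d → ℝ) (_ : Measurable (Function.uncurry fhat)),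
      ⨆ f ∈ {f | f ∈ F ∧ IsDensity f},
        ∫⁻ z, (adversarialLoss G (fhat z) f).toENNReal ∂(privateLaw (densityLaw f) Q)

end PrivateDensity

open PrivateDensity

/-!
The lower bound comes from a hypercube of densities `f_ν = 1 + (γ/K) ∑_k ν_k Ψ_k` with signs
`ν_k = ±1`, indexed by the `K = ∏ N_m` cells of an anisotropic grid, and from test functions
`g_μ = (ε/K) ∑_k μ_k χ_k`.

*Kernels.* Let `F_k` be the Fejér kernel of order `N` centred at `k/N`. In each coordinate `Ψ_k` is
`F_k(t) cos(4πNt)`, and `χ_k` has the further factor `2(1 + 2 cos(2πNt))`. The Fejér kernels are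
nonnegative, have mass one, vanish at all other grid points, and sum to `N`; hence `|f_ν - 1| ≤ γ`,
`|g_μ| ≤ 6^d ε` and `‖Ψ_k‖₁ ≤ 1`. Modulation gives `Ψ_k` mean zero. For a trigonometric polynomial
`p` of degree below `2N`,
`∫ p(t) (1 + 2 cos(2πNt)) (1 + cos(8πNt)) dt = (1/N) ∑_r p(r/N)`,
because the weight aliases frequencies exactly as the grid does. With `p = F_k F_l` this gives the
biorthogonality `∫ Ψ_k χ_l = K` if `k = l` and `0` otherwise (`integral_bump_mul_probe`). As all
frequencies in direction `m` are below a multiple of `N_m`, membership in the Sobolev balls follows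
from Bessel's inequality (`sum_weight_mul_fourierCoeff_le`) without any derivatives; the argument
works for real exponents.

*Loss.* Given an estimate `f̃`, estimate `ν_k` by the sign of `∫ (f̃ - 1) χ_k`. The adversary who
tests with the signs of the actual deviations shows that the loss is at least `εγ/K` times the
number of wrong signs (`le_adversarialLoss`). The latter is measurable in the data, unlike perhaps
the loss.

*Privacy.* Under local differential privacy, the conditional law of one private view changes by a
relative amount of at most `η = (e^α - 1) ‖f - f'‖₁` when the density changes from `f` to `f'`. In
the dual form `(∫ φ dP)² ≤ (1 + η²) ∫ φ² dP'` this `χ²`-bound tensorizes along the sequence of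
private views, also over spaces on which no jointly measurable densities exist
(`sq_lintegral_privateLaw_le`). For neighbours in the hypercube `‖f - f'‖₁ ≤ 2γ/K`, so that `nη²` is
small if `n α² γ² / K²` is, and Assouad's lemma gives the bound `εγ/4`
(`le_minimaxRate_of_hypercube`).

*Scale.* With `N_m ≈ M^{1/β_m}` one has `K ≈ M^{d/β}`, and the smoothness conditions allow
`γ ≈ 1/M`, `ε ≈ M^{-δ/β}`, where equal anisotropy enters. Taking `M = (nα²)^{β/(2β+2d)}` gives the
first rate; a grid of one cell with `γ ≈ (nα²)^{-1/2}` gives the second.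
-/

namespace PrivateDensity

/-! ### Waves, trigonometric polynomials and the one-dimensional Fourier basis -/

/-- The wave `t ↦ cos (2π m t + c)` of integer frequency `m` and phase `c`. -/
noncomputable def wave (m : ℤ) (c t : ℝ) : ℝ := Real.cos (2 * Real.pi * m * t + c)

theorem continuous_wave (m : ℤ) (c : ℝ) : Continuous (wave m c) := by
  unfold wave; fun_prop

theorem wave_mul_wave (m m' : ℤ) (c c' t : ℝ) :
    wave m c t * wave m' c' t = 1 / 2 * wave (m + m') (c + c') t
      + 1 / 2 * wave (m - m') (c - c') t := by
  unfold wave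
  have h1 : 2 * Real.pi * ((m + m' : ℤ) : ℝ) * t + (c + c')
    = (2 * Real.pi * m * t + c) + (2 * Real.pi * m' * t + c') := by push_cast; ring
  have h2 : 2 * Real.pi * ((m - m' : ℤ) : ℝ) * t + (c - c')
    = (2 * Real.pi * m * t + c) - (2 * Real.pi * m' * t + c') := by push_cast; ring
  rw [h1, h2, Real.cos_add (2 * Real.pi * m * t + c), Real.cos_sub (2 * Real.pi * m * t + c)]
  ring

theorem cos_two_pi_int_add (m : ℤ) (c : ℝ) : Real.cos (2 * Real.pi * m + c) = Real.cos c := by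
  rw [show 2 * Real.pi * m + c = c + m * (2 * Real.pi) by ring, Real.cos_add_int_mul_two_pi]

theorem sin_two_pi_int_add (m : ℤ) (c : ℝ) : Real.sin (2 * Real.pi * m + c) = Real.sin c := by
  rw [show 2 * Real.pi * m + c = c + m * (2 * Real.pi) by ring, Real.sin_add_int_mul_two_pi]

theorem integral_unitInterval (f : ℝ → ℝ) :
    ∫ t : unitInterval, f t = ∫ t in (0 : ℝ)..1, f t := by
  rw [intervalIntegral.integral_of_le zero_le_one, ← integral_Icc_eq_integral_Ioc]
  exact integral_subtype_comap measurableSet_Icc f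

theorem integral_wave (m : ℤ) (c : ℝ) :
    ∫ t : unitInterval, wave m c t = if m = 0 then Real.cos c else 0 := by
  rw [integral_unitInterval]
  split_ifs with h
  · simp [wave, h]
  · have h2 : 2 * Real.pi * (m : ℝ) ≠ 0 := by
      have : (m : ℝ) ≠ 0 := by exact_mod_cast h
      positivity
    unfold wave
    rw [intervalIntegral.integral_comp_mul_add (fun x => Real.cos x) h2 c, integral_cos]
    simp [sin_two_pi_int_add]

/-- Averages of a wave over the grid `{k / N}`: a geometric sum. -/
theorem sum_wave_grid (N : ℕ) (hN : 0 < N) (m : ℤ) (c : ℝ) :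
    ∑ k : Fin N, wave m c ((k : ℕ) / (N : ℝ)) = if (N : ℤ) ∣ m then N * Real.cos c else 0 := by
  have hN' : (N : ℝ) ≠ 0 := by positivity
  split_ifs with h
  · obtain ⟨q, rfl⟩ := h
    have : ∀ k : Fin N, wave (N * q) c ((k : ℕ) / (N : ℝ)) = Real.cos c := by
      intro k
      unfold wave
      rw [← cos_two_pi_int_add (q * (k : ℕ)) c]
      congr 1
      push_cast
      field_simp
    simp [this]
  · set ζ : ℂ := Complex.exp (2 * Real.pi * Complex.I * (m / N)) with hζ
    have hNC : (N : ℂ) ≠ 0 := by exact_mod_cast hN.ne'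
    have hζN : ζ ^ N = 1 := by
      rw [hζ, ← Complex.exp_nat_mul, Complex.exp_eq_one_iff]
      exact ⟨m, by field_simp⟩
    have hζ1 : ζ ≠ 1 := by
      intro h1
      rw [hζ, Complex.exp_eq_one_iff] at h1
      obtain ⟨q, hq⟩ := h1
      apply h
      refine ⟨q, ?_⟩
      have h3 : (m : ℂ) / N = q := by
        have h2 : (2 * Real.pi * Complex.I : ℂ) ≠ 0 := Complex.two_pi_I_ne_zero
        apply mul_left_cancel₀ h2
        rw [hq]; ring
      rw [div_eq_iff hNC] at h3
      have : (m : ℂ) = ((N * q : ℤ) : ℂ) := by rw [h3]; push_cast; ring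
      exact_mod_cast this
    have hsum : ∑ k ∈ Finset.range N, ζ ^ k = 0 := by
      have := mul_geom_sum ζ N
      rw [hζN, sub_self] at this
      rcases mul_eq_zero.1 this with h | h
      · exact absurd (sub_eq_zero.1 h) hζ1
      · exact h
    have hk : ∀ k : ℕ, wave m c (k / (N : ℝ)) = (Complex.exp (c * Complex.I) * ζ ^ k).re := by
      intro k
      rw [hζ, ← Complex.exp_nat_mul, ← Complex.exp_add]
      have : c * Complex.I + k * (2 * Real.pi * Complex.I * (m / N))
        = ((2 * Real.pi * m * (k / (N : ℝ)) + c : ℝ) : ℂ) * Complex.I := by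
        push_cast; ring
      rw [this, Complex.exp_ofReal_mul_I_re, wave]
    rw [Fin.sum_univ_eq_sum_range (fun k => wave m c (k / (N : ℝ))) N]
    simp_rw [hk]
    rw [← Complex.re_sum, ← Finset.mul_sum, hsum]
    simp

/-- Trigonometric polynomials of degree at most `q`. -/
noncomputable def trigPoly (q : ℕ) : Submodule ℝ (ℝ → ℝ) :=
  Submodule.span ℝ {f | ∃ (m : ℤ) (c : ℝ), m.natAbs ≤ q ∧ f = wave m c}

theorem wave_mem_trigPoly {q : ℕ} {m : ℤ} (h : m.natAbs ≤ q) (c : ℝ) : wave m c ∈ trigPoly q :=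
  Submodule.subset_span ⟨m, c, h, rfl⟩

theorem mul_mem_trigPoly {q q' : ℕ} {f g : ℝ → ℝ} (hf : f ∈ trigPoly q) (hg : g ∈ trigPoly q') :
    f * g ∈ trigPoly (q + q') := by
  have h : trigPoly q * trigPoly q' ≤ trigPoly (q + q') := by
    unfold trigPoly
    rw [Submodule.span_mul_span, Submodule.span_le]
    rintro _ ⟨_, ⟨m, c, hm, rfl⟩, _, ⟨m', c', hm', rfl⟩, rfl⟩
    have : wave m c * wave m' c' = (1 / 2 : ℝ) • wave (m + m') (c + c')
        + (1 / 2 : ℝ) • wave (m - m') (c - c') := by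
      ext t; simpa using wave_mul_wave m m' c c' t
    simp only [this]
    exact add_mem (Submodule.smul_mem _ _ (wave_mem_trigPoly (by omega) _))
      (Submodule.smul_mem _ _ (wave_mem_trigPoly (by omega) _))
  exact h (Submodule.mul_mem_mul hf hg)

theorem trigPoly_mono {q q' : ℕ} (h : q ≤ q') : trigPoly q ≤ trigPoly q' :=
  Submodule.span_mono fun _ ⟨m, c, hm, hf⟩ => ⟨m, c, hm.trans h, hf⟩

theorem continuous_of_mem_trigPoly {q : ℕ} {f : ℝ → ℝ} (hf : f ∈ trigPoly q) : Continuous f := by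
  induction hf using Submodule.span_induction with
  | mem f hf => obtain ⟨m, c, -, rfl⟩ := hf; exact continuous_wave m c
  | zero => exact continuous_const
  | add f g _ _ hf hg => exact hf.add hg
  | smul a f _ hf => exact hf.const_smul a

theorem integrable_unitInterval {f : ℝ → ℝ} (hf : Continuous f) :
    Integrable (fun t : unitInterval => f t) :=
  (hf.comp continuous_subtype_val).integrable_of_hasCompactSupport
    (HasCompactSupport.of_compactSpace _)

/-- Two linear functionals of a trigonometric polynomial agree when they agree on waves: here an
integral against a continuous weight is compared with a weighted sum of point values. -/
theorem integral_trigPoly_eq_sum {q : ℕ} {w : ℝ → ℝ} (hw : Continuous w) {ι : Type*}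
    (s : Finset ι) (a x : ι → ℝ)
    (h : ∀ (m : ℤ) (c : ℝ), m.natAbs ≤ q →
      ∫ t : unitInterval, wave m c t * w t = ∑ i ∈ s, a i * wave m c (x i))
    {f : ℝ → ℝ} (hf : f ∈ trigPoly q) :
    ∫ t : unitInterval, f t * w t = ∑ i ∈ s, a i * f (x i) := by
  induction hf using Submodule.span_induction with
  | mem f hf => obtain ⟨m, c, hm, rfl⟩ := hf; exact h m c hm
  | zero => simp
  | add f g hf hg ihf ihg =>
    simp only [Pi.add_apply, add_mul, mul_add, Finset.sum_add_distrib]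
    rw [integral_add, ihf, ihg]
    · exact integrable_unitInterval ((continuous_of_mem_trigPoly hf).mul hw)
    · exact integrable_unitInterval ((continuous_of_mem_trigPoly hg).mul hw)
  | smul b f hf ihf =>
    simp only [Pi.smul_apply, smul_eq_mul, mul_assoc, mul_left_comm _ b]
    rw [integral_const_mul, ihf, Finset.mul_sum]

theorem fourierOne_eq (j : ℕ+) (t : ℝ) :
    fourierOne j t = (if j = 1 then 1 else Real.sqrt 2) *
      wave (((j : ℕ) / 2 : ℕ) : ℤ) (if j = 1 ∨ Even (j : ℕ) then 0 else -(Real.pi / 2)) t := by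
  unfold fourierOne wave
  by_cases h1 : j = 1
  · simp [h1]
  · by_cases h2 : Even (j : ℕ)
    · simp only [h1, h2, if_true, if_false, or_true, add_zero]
      push_cast
      rfl
    · simp only [h1, h2, if_false, or_self]
      rw [← sub_eq_add_neg, Real.cos_sub_pi_div_two]
      push_cast
      rfl

theorem continuous_fourierOne (j : ℕ+) : Continuous (fourierOne j) := by
  have : fourierOne j = fun t => _ := funext fun t => fourierOne_eq j t
  rw [this]
  exact continuous_const.mul (continuous_wave _ _)

theorem integral_wave_mul_wave (m m' : ℤ) (c c' : ℝ) :
    ∫ t : unitInterval, wave m c t * wave m' c' t =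
      1 / 2 * (if m + m' = 0 then Real.cos (c + c') else 0)
        + 1 / 2 * (if m - m' = 0 then Real.cos (c - c') else 0) := by
  simp_rw [wave_mul_wave]
  rw [integral_add, integral_const_mul, integral_const_mul, integral_wave, integral_wave]
  · exact (integrable_unitInterval (continuous_wave _ _)).const_mul _
  · exact (integrable_unitInterval (continuous_wave _ _)).const_mul _

/-- A trigonometric polynomial has no Fourier coefficients above its degree. -/
theorem integral_mul_fourierOne_eq_zero {q : ℕ} {f : ℝ → ℝ} (hf : f ∈ trigPoly q) {j : ℕ+}
    (hj : q < (j : ℕ) / 2) : ∫ t : unitInterval, f t * fourierOne j t = 0 := by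
  rw [integral_trigPoly_eq_sum (continuous_fourierOne j) (∅ : Finset ℕ) 0 0 _ hf]
  · simp
  · intro m c hm
    simp_rw [fourierOne_eq, mul_left_comm (wave _ _ _)]
    rw [integral_const_mul, integral_wave_mul_wave,
      if_neg (show ¬ m + (((j : ℕ) / 2 : ℕ) : ℤ) = 0 by omega),
      if_neg (show ¬ m - (((j : ℕ) / 2 : ℕ) : ℤ) = 0 by omega)]
    simp

theorem integral_fourierOne_mul (i j : ℕ+) :
    ∫ t : unitInterval, fourierOne i t * fourierOne j t = if i = j then 1 else 0 := by
  simp_rw [fourierOne_eq, mul_mul_mul_comm _ (wave _ _ _)]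
  rw [integral_const_mul, integral_wave_mul_wave]
  have hi := i.pos
  have hj := j.pos
  have e1 : ∀ i : ℕ+, i = 1 ↔ (i : ℕ) = 1 := fun i => by rw [← PNat.coe_inj]; rfl
  have h2 : Real.sqrt 2 * Real.sqrt 2 = 2 := Real.mul_self_sqrt (by norm_num)
  have hc : Real.cos (-(Real.pi / 2)) = 0 := by rw [Real.cos_neg, Real.cos_pi_div_two]
  by_cases hij : i = j
  · subst hij
    by_cases h1 : i = 1
    · subst h1; norm_num
    · have h1' := mt (e1 i).2 h1
      rw [if_neg (show ¬ (((i : ℕ) / 2 : ℕ) : ℤ) + (((i : ℕ) / 2 : ℕ) : ℤ) = 0 by omega)]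
      simp [h1, h2]
  · have hij' : (i : ℕ) ≠ j := fun h => hij (PNat.coe_inj.1 h)
    rw [if_neg hij]
    by_cases hk : (i : ℕ) / 2 = (j : ℕ) / 2
    · have h1 : i ≠ 1 := by rw [Ne, e1]; omega
      have h1' : j ≠ 1 := by rw [Ne, e1]; omega
      have h1n := mt (e1 i).2 h1
      rw [if_neg (show ¬ (((i : ℕ) / 2 : ℕ) : ℤ) + (((j : ℕ) / 2 : ℕ) : ℤ) = 0 by omega),
        if_pos (show (((i : ℕ) / 2 : ℕ) : ℤ) - (((j : ℕ) / 2 : ℕ) : ℤ) = 0 by omega)]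
      by_cases hE : Even (i : ℕ)
      · have hO : ¬ Even (j : ℕ) := by rw [Nat.even_iff] at *; omega
        simp [h1, h1', hE, hO]
      · have hO : Even (j : ℕ) := by rw [Nat.even_iff] at *; omega
        simp [h1, h1', hE, hO]
    · rw [if_neg (show ¬ (((i : ℕ) / 2 : ℕ) : ℤ) + (((j : ℕ) / 2 : ℕ) : ℤ) = 0 by omega),
        if_neg (show ¬ (((i : ℕ) / 2 : ℕ) : ℤ) - (((j : ℕ) / 2 : ℕ) : ℤ) = 0 by omega)]
      simp

/-! ### Modulated Fejér kernels on a grid -/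

/-- The Fejér kernel `(1/N) |∑_{j < N} e^{2πij(t - s)}|²` centred at `s`, written as a double sum
of waves. -/
noncomputable def fejer (N : ℕ) (s t : ℝ) : ℝ :=
  1 / N * ∑ i : Fin N, ∑ j : Fin N,
    wave ((i : ℕ) - (j : ℕ) : ℤ) (-(2 * Real.pi * ((i : ℕ) - (j : ℕ) : ℤ) * s)) t

theorem fejer_eq (N : ℕ) (s t : ℝ) :
    fejer N s t = 1 / N * ((∑ i : Fin N, Real.cos (2 * Real.pi * (i : ℕ) * (t - s))) ^ 2
      + (∑ i : Fin N, Real.sin (2 * Real.pi * (i : ℕ) * (t - s))) ^ 2) := by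
  unfold fejer
  congr 1
  rw [sq, sq, Finset.sum_mul_sum, Finset.sum_mul_sum, ← Finset.sum_add_distrib]
  refine Finset.sum_congr rfl fun i _ => ?_
  rw [← Finset.sum_add_distrib]
  refine Finset.sum_congr rfl fun j _ => ?_
  rw [← Real.cos_sub]
  unfold wave
  congr 1
  push_cast
  ring

theorem fejer_nonneg (N : ℕ) (s t : ℝ) : 0 ≤ fejer N s t := by
  rw [fejer_eq]; positivity

theorem fejer_mem_trigPoly (N : ℕ) (s : ℝ) : fejer N s ∈ trigPoly (N - 1) := by
  have : fejer N s = (1 / N : ℝ) • ∑ i : Fin N, ∑ j : Fin N,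
      wave ((i : ℕ) - (j : ℕ) : ℤ) (-(2 * Real.pi * ((i : ℕ) - (j : ℕ) : ℤ) * s)) := by
    ext t; simp [fejer]
  rw [this]
  exact Submodule.smul_mem _ _ (sum_mem fun i _ => sum_mem fun j _ =>
    wave_mem_trigPoly (by omega) _)

theorem integral_fejer {N : ℕ} (hN : 0 < N) (s : ℝ) :
    ∫ t : unitInterval, fejer N s t = 1 := by
  have hN' : (N : ℝ) ≠ 0 := by positivity
  have hint : ∀ m c, Integrable (fun t : unitInterval => wave m c t) :=
    fun m c => integrable_unitInterval (continuous_wave m c)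
  unfold fejer
  rw [integral_const_mul, integral_finsetSum _
    fun i _ => integrable_finsetSum _ fun j _ => hint _ _]
  have : ∀ i : Fin N, ∫ t : unitInterval, ∑ j : Fin N,
      wave ((i : ℕ) - (j : ℕ) : ℤ) (-(2 * Real.pi * ((i : ℕ) - (j : ℕ) : ℤ) * s)) t = 1 := by
    intro i
    rw [integral_finsetSum _ fun j _ => hint _ _, Finset.sum_eq_single i]
    · simp [integral_wave]
    · intro j _ hj
      rw [integral_wave, if_neg]
      intro h
      exact hj (Fin.ext (by omega))
    · simp
  simp_rw [this]
  simp [hN']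

theorem int_dvd_sub_iff {N : ℕ} (i j : Fin N) : (N : ℤ) ∣ (i : ℕ) - (j : ℕ) ↔ i = j := by
  constructor
  · intro h
    have := Int.eq_zero_of_abs_lt_dvd h (by
      have := i.2
      have := j.2
      rw [abs_lt]
      constructor <;> omega)
    exact Fin.ext (by omega)
  · rintro rfl; simp

/-- The Fejér kernels centred at the grid points are a partition of `N`. -/
theorem sum_fejer {N : ℕ} (hN : 0 < N) (t : ℝ) :
    ∑ k : Fin N, fejer N ((k : ℕ) / (N : ℝ)) t = N := by
  have hN' : (N : ℝ) ≠ 0 := by positivity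
  unfold fejer
  rw [← Finset.mul_sum, Finset.sum_comm]
  have : ∀ i : Fin N, ∑ k : Fin N, ∑ j : Fin N,
      wave ((i : ℕ) - (j : ℕ) : ℤ)
        (-(2 * Real.pi * ((i : ℕ) - (j : ℕ) : ℤ) * ((k : ℕ) / (N : ℝ)))) t = N := by
    intro i
    rw [Finset.sum_comm]
    have h : ∀ j k : Fin N, wave ((i : ℕ) - (j : ℕ) : ℤ)
        (-(2 * Real.pi * ((i : ℕ) - (j : ℕ) : ℤ) * ((k : ℕ) / (N : ℝ)))) t
        = wave ((j : ℕ) - (i : ℕ) : ℤ) (2 * Real.pi * ((i : ℕ) - (j : ℕ) : ℤ) * t)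
          ((k : ℕ) / (N : ℝ)) := by
      intro j k
      unfold wave
      congr 1
      push_cast
      ring
    simp_rw [h, sum_wave_grid N hN, int_dvd_sub_iff]
    simp
  simp_rw [this]
  simp [hN']

theorem fejer_grid {N : ℕ} (hN : 0 < N) (k r : Fin N) :
    fejer N ((k : ℕ) / (N : ℝ)) ((r : ℕ) / (N : ℝ)) = if k = r then (N : ℝ) else 0 := by
  have hN' : (N : ℝ) ≠ 0 := by positivity
  rw [fejer_eq]
  split_ifs with h
  · subst h
    simp
    field_simp
  · have hr : ¬ (N : ℤ) ∣ (r : ℕ) - (k : ℕ) := by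
      rw [int_dvd_sub_iff]; exact fun h' => h h'.symm
    have h1 := sum_wave_grid N hN ((r : ℕ) - (k : ℕ)) 0
    have h2 := sum_wave_grid N hN ((r : ℕ) - (k : ℕ)) (-(Real.pi / 2))
    rw [if_neg hr] at h1 h2
    have e1 : ∀ i : Fin N, Real.cos (2 * Real.pi * (i : ℕ) * ((r : ℕ) / (N : ℝ) - (k : ℕ) / (N : ℝ)))
        = wave ((r : ℕ) - (k : ℕ)) 0 ((i : ℕ) / (N : ℝ)) := by
      intro i; unfold wave; congr 1; push_cast; ring
    have e2 : ∀ i : Fin N, Real.sin (2 * Real.pi * (i : ℕ) * ((r : ℕ) / (N : ℝ) - (k : ℕ) / (N : ℝ)))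
        = wave ((r : ℕ) - (k : ℕ)) (-(Real.pi / 2)) ((i : ℕ) / (N : ℝ)) := by
      intro i; unfold wave; rw [← sub_eq_add_neg, Real.cos_sub_pi_div_two]
      congr 1; push_cast; ring
    simp_rw [e1, e2, h1, h2]
    simp

/-- The perturbation kernel of cell `k`: a Fejér kernel, modulated by a wave of frequency `2N` so
that its mean is zero. -/
noncomputable def bump (N : ℕ) (k : Fin N) (t : ℝ) : ℝ :=
  fejer N ((k : ℕ) / (N : ℝ)) t * wave (2 * N) 0 t

/-- The test kernel of cell `k`. The additional weight `2 (1 + 2 cos (2πNt))` makes these kernels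
biorthogonal to the perturbation kernels, see `integral_bump_mul_probe`. -/
noncomputable def probe (N : ℕ) (k : Fin N) (t : ℝ) : ℝ :=
  bump N k t * (2 * (1 + 2 * wave N 0 t))

theorem abs_wave_le (m : ℤ) (c t : ℝ) : |wave m c t| ≤ 1 := Real.abs_cos_le_one _

theorem abs_bump_le (N : ℕ) (k : Fin N) (t : ℝ) :
    |bump N k t| ≤ fejer N ((k : ℕ) / (N : ℝ)) t := by
  rw [bump, abs_mul, abs_of_nonneg (fejer_nonneg _ _ _)]
  exact mul_le_of_le_one_right (fejer_nonneg _ _ _) (abs_wave_le _ _ _)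

theorem abs_probe_le (N : ℕ) (k : Fin N) (t : ℝ) :
    |probe N k t| ≤ 6 * fejer N ((k : ℕ) / (N : ℝ)) t := by
  rw [probe, abs_mul, mul_comm 6]
  refine mul_le_mul (abs_bump_le N k t) ?_ (abs_nonneg _) (fejer_nonneg _ _ _)
  have := abs_le.1 (abs_wave_le N 0 t)
  rw [abs_le]; constructor <;> linarith

theorem bump_mem_trigPoly {N : ℕ} (k : Fin N) : bump N k ∈ trigPoly (4 * N) := by
  have h := mul_mem_trigPoly (fejer_mem_trigPoly N ((k : ℕ) / (N : ℝ)))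
    (wave_mem_trigPoly (q := 2 * N) (m := 2 * N) (by omega) 0)
  exact trigPoly_mono (by omega) h

theorem probe_mem_trigPoly {N : ℕ} (k : Fin N) : probe N k ∈ trigPoly (4 * N) := by
  have h := mul_mem_trigPoly (fejer_mem_trigPoly N ((k : ℕ) / (N : ℝ)))
    (wave_mem_trigPoly (q := 2 * N) (m := 2 * N) (by omega) 0)
  have h2 : (fun t => 2 * (1 + 2 * wave N 0 t)) ∈ trigPoly N := by
    have : (fun t => 2 * (1 + 2 * wave N 0 t)) = (2 : ℝ) • wave 0 0 + (4 : ℝ) • wave N 0 := by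
      ext t; simp [wave]; ring
    rw [this]
    exact add_mem (Submodule.smul_mem _ _ (wave_mem_trigPoly (by omega) _))
      (Submodule.smul_mem _ _ (wave_mem_trigPoly (by omega) _))
  exact trigPoly_mono (by omega) (mul_mem_trigPoly h h2)

theorem continuous_fejer (N : ℕ) (s : ℝ) : Continuous (fejer N s) :=
  continuous_of_mem_trigPoly (fejer_mem_trigPoly N s)

theorem continuous_bump {N : ℕ} (k : Fin N) : Continuous (bump N k) :=
  continuous_of_mem_trigPoly (bump_mem_trigPoly k)

theorem continuous_probe {N : ℕ} (k : Fin N) : Continuous (probe N k) :=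
  continuous_of_mem_trigPoly (probe_mem_trigPoly k)

theorem integral_bump {N : ℕ} (hN : 0 < N) (k : Fin N) : ∫ t : unitInterval, bump N k t = 0 := by
  unfold bump
  rw [integral_trigPoly_eq_sum (continuous_wave _ _) (∅ : Finset ℕ) 0 0 _
    (fejer_mem_trigPoly N ((k : ℕ) / (N : ℝ)))]
  · simp
  · intro m c hm
    rw [integral_wave_mul_wave, if_neg (show ¬ m + 2 * (N : ℤ) = 0 by omega),
      if_neg (show ¬ m - 2 * (N : ℤ) = 0 by omega)]
    simp

/-- Integrating a wave of frequency below `2N` against the product of the two modulations averages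
it over the grid. -/
theorem integral_wave_mul_weight {N : ℕ} (hN : 0 < N) (m : ℤ) (c : ℝ)
    (hm : m.natAbs ≤ N - 1 + (N - 1)) :
    ∫ t : unitInterval, wave m c t *
        (wave (2 * N) 0 t * (wave (2 * N) 0 t * (2 * (1 + 2 * wave N 0 t))))
      = ∑ r : Fin N, 1 / N * wave m c ((r : ℕ) / (N : ℝ)) := by
  have hN' : (N : ℝ) ≠ 0 := by positivity
  have hw : ∀ t : ℝ, wave m c t *
      (wave (2 * N) 0 t * (wave (2 * N) 0 t * (2 * (1 + 2 * wave N 0 t)))) =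
      wave m c t * wave 0 0 t + 2 * (wave m c t * wave N 0 t) + wave m c t * wave (4 * N) 0 t
        + (wave m c t * wave (5 * N) 0 t + wave m c t * wave (3 * N) 0 t) := by
    intro t
    have h1 := wave_mul_wave (2 * N) (2 * N) 0 0 t
    have h2 := wave_mul_wave (4 * N) N 0 0 t
    have e1 : (2 * N + 2 * N : ℤ) = 4 * N := by ring
    have e2 : (4 * N + N : ℤ) = 5 * N := by ring
    have e3 : (4 * N - N : ℤ) = 3 * N := by ring
    have h0 : wave 0 0 t = 1 := by simp [wave]
    rw [e1, sub_self, add_zero, sub_zero, h0] at h1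
    rw [e2, e3, add_zero, sub_zero] at h2
    rw [h0]
    linear_combination (2 * wave m c t * (1 + 2 * wave N 0 t)) * h1 + 2 * wave m c t * h2
  have hc : ∀ m' c', Continuous (fun t : unitInterval => wave m' c' t) :=
    fun m' c' => (continuous_wave m' c').comp continuous_subtype_val
  have hint : ∀ g : unitInterval → ℝ, Continuous g → Integrable g :=
    fun g hg => hg.integrable_of_hasCompactSupport (HasCompactSupport.of_compactSpace _)
  simp_rw [hw]
  rw [integral_add (hint _ (by fun_prop)) (hint _ (by fun_prop)),
    integral_add (hint _ (by fun_prop)) (hint _ (by fun_prop)),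
    integral_add (hint _ (by fun_prop)) (hint _ (by fun_prop)),
    integral_add (hint _ (by fun_prop)) (hint _ (by fun_prop)), integral_const_mul]
  simp_rw [integral_wave_mul_wave]
  rw [← Finset.mul_sum, sum_wave_grid N hN]
  rw [if_neg (show ¬ m + 4 * (N : ℤ) = 0 by omega), if_neg (show ¬ m - 4 * (N : ℤ) = 0 by omega),
    if_neg (show ¬ m + 5 * (N : ℤ) = 0 by omega), if_neg (show ¬ m - 5 * (N : ℤ) = 0 by omega),
    if_neg (show ¬ m + 3 * (N : ℤ) = 0 by omega), if_neg (show ¬ m - 3 * (N : ℤ) = 0 by omega)]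
  by_cases hd : (N : ℤ) ∣ m
  · obtain ⟨q, rfl⟩ := hd
    have hq : q = 0 ∨ q = 1 ∨ q = -1 := by
      have h1 : q < 2 := by
        by_contra h
        have : (N : ℤ) * 2 ≤ N * q := by gcongr; omega
        omega
      have h2 : -2 < q := by
        by_contra h
        have : (N : ℤ) * q ≤ N * (-2) := by gcongr; omega
        omega
      omega
    have hNz2 : (N : ℤ) + N ≠ 0 := by omega
    have hNz3 : -(N : ℤ) - N ≠ 0 := by omega
    rcases hq with rfl | rfl | rfl
    · simp [hN.ne']; ring
    · simp [hN.ne', hNz2]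
    · simp [hN.ne', hNz3]
  · have h0 : m ≠ 0 := by rintro rfl; simp at hd
    have h1 : m + N ≠ 0 := by
      intro h; exact hd ⟨-1, by linarith⟩
    have h2 : m - N ≠ 0 := by
      intro h; exact hd ⟨1, by linarith⟩
    simp [hd, h0, h1, h2]

theorem integral_bump_mul_probe {N : ℕ} (hN : 0 < N) (k l : Fin N) :
    ∫ t : unitInterval, bump N k t * probe N l t = if k = l then (N : ℝ) else 0 := by
  have hN' : (N : ℝ) ≠ 0 := by positivity
  have h := integral_trigPoly_eq_sum
    (w := fun t => wave (2 * N) 0 t * (wave (2 * N) 0 t * (2 * (1 + 2 * wave N 0 t))))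
    (by have := continuous_wave; fun_prop) Finset.univ (fun _ : Fin N => 1 / (N : ℝ))
    (fun r => (r : ℕ) / (N : ℝ)) (fun m c hm => integral_wave_mul_weight hN m c hm)
    (mul_mem_trigPoly (fejer_mem_trigPoly N ((k : ℕ) / (N : ℝ)))
      (fejer_mem_trigPoly N ((l : ℕ) / (N : ℝ))))
  have e : ∀ t : ℝ, bump N k t * probe N l t =
      (fejer N ((k : ℕ) / (N : ℝ)) * fejer N ((l : ℕ) / (N : ℝ))) t *
      (wave (2 * N) 0 t * (wave (2 * N) 0 t * (2 * (1 + 2 * wave N 0 t)))) := by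
    intro t; simp only [bump, probe, Pi.mul_apply]; ring
  simp_rw [e]
  rw [h]
  simp only [Pi.mul_apply, fejer_grid hN]
  rw [Finset.sum_eq_single k]
  · by_cases hkl : k = l
    · simp [hkl, hN']
    · have := Ne.symm hkl
      simp [hkl, this]
  · intro r _ hr
    simp [hr.symm]
  · simp

/-! ### Bessel's inequality and Sobolev balls on the cube -/

theorem integrable_cube {d : ℕ} {f : Cube d → ℝ} (hf : Continuous f) : Integrable f :=
  hf.integrable_of_hasCompactSupport (HasCompactSupport.of_compactSpace _)

theorem integral_prod_cube {d : ℕ} (f : Fin d → ℝ → ℝ) :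
    ∫ x : Cube d, ∏ m, f m (x m) = ∏ m, ∫ t : unitInterval, f m t :=
  integral_fintype_prod_volume_eq_prod (fun m (t : unitInterval) => f m t)

theorem continuous_prod_cube {d : ℕ} {f : Fin d → ℝ → ℝ} (hf : ∀ m, Continuous (f m)) :
    Continuous (fun x : Cube d => ∏ m, f m (x m)) := by
  fun_prop

theorem continuous_fourierBasis {d : ℕ} (j : Fin d → ℕ+) :
    Continuous (fourierBasis j : Cube d → ℝ) :=
  continuous_prod_cube fun m => continuous_fourierOne (j m)

theorem integral_fourierBasis_mul {d : ℕ} (i j : Fin d → ℕ+) :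
    ∫ x : Cube d, fourierBasis i x * fourierBasis j x = if i = j then 1 else 0 := by
  unfold fourierBasis
  simp_rw [← Finset.prod_mul_distrib]
  rw [integral_prod_cube (fun m t => fourierOne (i m) t * fourierOne (j m) t)]
  simp_rw [integral_fourierOne_mul]
  rw [Finset.prod_ite_zero]
  simp [funext_iff]

/-- Bessel's inequality for the Fourier basis. -/
theorem sum_sq_fourierCoeff_le {d : ℕ} {h : Cube d → ℝ} (hc : Continuous h)
    (s : Finset (Fin d → ℕ+)) : ∑ j ∈ s, fourierCoeff j h ^ 2 ≤ ∫ x, h x ^ 2 := by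
  have hφ := fun j : Fin d → ℕ+ => continuous_fourierBasis j
  have e : ∀ x, (h x - ∑ j ∈ s, fourierCoeff j h * fourierBasis j x) ^ 2 = h x ^ 2
      - 2 * ∑ j ∈ s, fourierCoeff j h * (h x * fourierBasis j x)
      + ∑ i ∈ s, ∑ j ∈ s, fourierCoeff i h * fourierCoeff j h *
        (fourierBasis i x * fourierBasis j x) := by
    intro x
    have e1 : ∑ j ∈ s, fourierCoeff j h * (h x * fourierBasis j x)
        = h x * ∑ j ∈ s, fourierCoeff j h * fourierBasis j x := by
      rw [Finset.mul_sum]; exact Finset.sum_congr rfl fun j _ => by ring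
    have e2 : ∑ i ∈ s, ∑ j ∈ s, fourierCoeff i h * fourierCoeff j h *
        (fourierBasis i x * fourierBasis j x)
        = (∑ j ∈ s, fourierCoeff j h * fourierBasis j x) ^ 2 := by
      rw [sq, Finset.sum_mul_sum]
      exact Finset.sum_congr rfl fun i _ => Finset.sum_congr rfl fun j _ => by ring
    rw [e1, e2]; ring
  have h0 : 0 ≤ ∫ x, (h x - ∑ j ∈ s, fourierCoeff j h * fourierBasis j x) ^ 2 :=
    integral_nonneg fun x => sq_nonneg _
  simp_rw [e] at h0
  rw [integral_add (integrable_cube (by fun_prop)) (integrable_cube (by fun_prop)),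
    integral_sub (integrable_cube (by fun_prop)) (integrable_cube (by fun_prop)),
    integral_const_mul,
    integral_finsetSum _ fun j _ => integrable_cube (by fun_prop),
    integral_finsetSum _ fun j _ => integrable_cube (by fun_prop)] at h0
  have e3 : ∑ j ∈ s, ∫ x, fourierCoeff j h * (h x * fourierBasis j x)
      = ∑ j ∈ s, fourierCoeff j h ^ 2 :=
    Finset.sum_congr rfl fun j _ => by rw [integral_const_mul, sq]; rfl
  have e4 : ∑ i ∈ s, ∫ x, ∑ j ∈ s, fourierCoeff i h * fourierCoeff j h *
        (fourierBasis i x * fourierBasis j x) = ∑ j ∈ s, fourierCoeff j h ^ 2 := by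
    refine Finset.sum_congr rfl fun i hi => ?_
    rw [integral_finsetSum _ fun j _ => integrable_cube (by fun_prop)]
    simp_rw [integral_const_mul, integral_fourierBasis_mul]
    simp [hi, sq]
  rw [e3, e4] at h0
  linarith

/-- The Sobolev weight at the corner of a box of frequencies. -/
noncomputable def boxWeight {d : ℕ} (β : Fin d → ℝ) (D : Fin d → ℝ) : ℝ :=
  ∑ m, D m ^ (2 * β m)

theorem boxWeight_nonneg {d : ℕ} (β : Fin d → ℝ) {D : Fin d → ℝ} (hD : ∀ m, 0 ≤ D m) :
    0 ≤ boxWeight β D :=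
  Finset.sum_nonneg fun m _ => Real.rpow_nonneg (hD m) _

/-- The Sobolev sum of a bounded function with frequencies in a box is at most the weight at the
corner of the box times the squared bound. -/
theorem sum_weight_mul_fourierCoeff_le {d : ℕ} {β : Fin d → ℝ} (hβ : ∀ m, 0 ≤ β m)
    {D : Fin d → ℝ} (hD0 : ∀ m, 0 ≤ D m) {h : Cube d → ℝ} (hc : Continuous h) {B : ℝ}
    (hB : ∀ x, |h x| ≤ B)
    (hD : ∀ j : Fin d → ℕ+, (∃ m, D m < (j m : ℕ)) → fourierCoeff j h = 0)
    (s : Finset (Fin d → ℕ+)) :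
    ∑ j ∈ s, (∑ m, ((j m : ℕ) : ℝ) ^ (2 * β m)) * fourierCoeff j h ^ 2
      ≤ boxWeight β D * B ^ 2 := by
  calc ∑ j ∈ s, (∑ m, ((j m : ℕ) : ℝ) ^ (2 * β m)) * fourierCoeff j h ^ 2
      ≤ ∑ j ∈ s, boxWeight β D * fourierCoeff j h ^ 2 := by
        refine Finset.sum_le_sum fun j _ => ?_
        by_cases hj : ∃ m, D m < (j m : ℕ)
        · simp [hD j hj]
        · push Not at hj
          refine mul_le_mul_of_nonneg_right (Finset.sum_le_sum fun m _ => ?_) (sq_nonneg _)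
          exact Real.rpow_le_rpow (Nat.cast_nonneg _) (hj m) (by have := hβ m; positivity)
    _ = boxWeight β D * ∑ j ∈ s, fourierCoeff j h ^ 2 := by rw [Finset.mul_sum]
    _ ≤ boxWeight β D * B ^ 2 := by
        refine mul_le_mul_of_nonneg_left ?_ (boxWeight_nonneg β hD0)
        refine (sum_sq_fourierCoeff_le hc s).trans ?_
        calc ∫ x, h x ^ 2 ≤ ∫ _ : Cube d, B ^ 2 :=
              integral_mono (integrable_cube (by fun_prop)) (integrable_const _) fun x => by
                rw [← sq_abs (h x)]
                exact pow_le_pow_left₀ (abs_nonneg _) (hB x) 2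
          _ = B ^ 2 := by simp

theorem mem_sobolevBall_of_sum_le {d : ℕ} {β : Fin d → ℝ} {R : ℝ} {f : Cube d → ℝ}
    (hf : Continuous f)
    (h : ∀ s : Finset (Fin d → ℕ+),
      ∑ j ∈ s, (∑ m, ((j m : ℕ) : ℝ) ^ (2 * β m)) * fourierCoeff j f ^ 2 ≤ R ^ 2) :
    f ∈ sobolevBall β R := by
  constructor
  · rw [memLp_two_iff_integrable_sq hf.aestronglyMeasurable]
    exact integrable_cube (by fun_prop)
  · rw [ENNReal.tsum_eq_iSup_sum]
    refine iSup_le fun s => ?_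
    rw [← ENNReal.ofReal_sum_of_nonneg]
    · exact ENNReal.ofReal_le_ofReal (h s)
    · intro j _
      positivity

theorem mem_sobolevBall_of_band {d : ℕ} {β : Fin d → ℝ} (hβ : ∀ m, 0 ≤ β m)
    {D : Fin d → ℝ} (hD0 : ∀ m, 0 ≤ D m) {h : Cube d → ℝ} (hc : Continuous h) {B R : ℝ}
    (hB : ∀ x, |h x| ≤ B)
    (hD : ∀ j : Fin d → ℕ+, (∃ m, D m < (j m : ℕ)) → fourierCoeff j h = 0)
    (hR : boxWeight β D * B ^ 2 ≤ R ^ 2) : h ∈ sobolevBall β R :=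
  mem_sobolevBall_of_sum_le hc fun s =>
    (sum_weight_mul_fourierCoeff_le hβ hD0 hc hB hD s).trans hR

theorem fourierBasis_one {d : ℕ} (x : Cube d) : fourierBasis (1 : Fin d → ℕ+) x = 1 := by
  simp [fourierBasis, fourierOne]

/-- Perturbing the uniform density, whose Sobolev sum is `d`, by a function of mean zero. -/
theorem one_add_mem_sobolevBall {d : ℕ} {β : Fin d → ℝ} (hβ : ∀ m, 0 ≤ β m)
    {D : Fin d → ℝ} (hD0 : ∀ m, 0 ≤ D m) {h : Cube d → ℝ} (hc : Continuous h) {B R : ℝ}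
    (hB : ∀ x, |h x| ≤ B)
    (hD : ∀ j : Fin d → ℕ+, (∃ m, D m < (j m : ℕ)) → fourierCoeff j h = 0)
    (h0 : ∫ x, h x = 0)
    (hR : boxWeight β D * B ^ 2 ≤ R ^ 2 - d) : (fun x => 1 + h x) ∈ sobolevBall β R := by
  refine mem_sobolevBall_of_sum_le (by fun_prop) fun s => ?_
  have hφ := fun j : Fin d → ℕ+ => continuous_fourierBasis j
  have hcoef : ∀ j : Fin d → ℕ+, fourierCoeff j (fun x => 1 + h x)
      = (if 1 = j then 1 else 0) + fourierCoeff j h := by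
    intro j
    unfold fourierCoeff
    rw [← integral_fourierBasis_mul, ← integral_add (integrable_cube (by fun_prop))
      (integrable_cube (by fun_prop))]
    congr 1
    ext x
    rw [fourierBasis_one]
    ring
  have hone : fourierCoeff 1 h = 0 := by
    unfold fourierCoeff
    simp_rw [fourierBasis_one, mul_one]
    exact h0
  have hsplit : ∀ j : Fin d → ℕ+, (∑ m, ((j m : ℕ) : ℝ) ^ (2 * β m)) *
      fourierCoeff j (fun x => 1 + h x) ^ 2 = (if 1 = j then (d : ℝ) else 0) +
      (∑ m, ((j m : ℕ) : ℝ) ^ (2 * β m)) * fourierCoeff j h ^ 2 := by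
    intro j
    rw [hcoef]
    by_cases hj : 1 = j
    · subst hj
      simp [hone]
    · simp [hj]
  simp_rw [hsplit]
  rw [Finset.sum_add_distrib]
  have h1 : ∑ j ∈ s, (if 1 = j then (d : ℝ) else 0) ≤ d := by
    rw [Finset.sum_ite_eq]
    split_ifs
    · exact le_rfl
    · positivity
  have h2 := sum_weight_mul_fourierCoeff_le hβ hD0 hc hB hD s
  linarith

/-! ### Sums of localized kernels over the cells of a grid -/

/-- The indices of the cells of a grid with `N m` cells in direction `m`. -/
abbrev Cell {d : ℕ} (N : Fin d → ℕ) : Type := ∀ m, Fin (N m)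

/-- The number of cells, as a real number. -/
def cellCount {d : ℕ} (N : Fin d → ℕ) : ℝ := ∏ m, (N m : ℝ)

/-- The combination with coefficients `a` of tensor products of one-dimensional kernels. -/
noncomputable def cellSum {d : ℕ} {N : Fin d → ℕ} (g : ∀ m, Fin (N m) → ℝ → ℝ) (a : Cell N → ℝ)
    (x : Cube d) : ℝ :=
  ∑ k, a k * ∏ m, g m (k m) (x m)

section CellSum

variable {d : ℕ} {N : Fin d → ℕ} {g : ∀ m, Fin (N m) → ℝ → ℝ} {C : ℝ}

theorem continuous_cellSum (hg : ∀ m k, Continuous (g m k)) (a : Cell N → ℝ) :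
    Continuous (cellSum g a) :=
  continuous_finsetSum _ fun k _ =>
    continuous_const.mul (continuous_prod_cube fun m => hg m (k m))

theorem sum_prod_fejer (hN : ∀ m, 0 < N m) (x : Cube d) :
    ∑ k : Cell N, ∏ m, fejer (N m) (((k m : Fin (N m)) : ℕ) / (N m : ℝ)) (x m) = cellCount N := by
  rw [← Fintype.prod_sum fun m (k : Fin (N m)) => fejer (N m) ((k : ℕ) / (N m : ℝ)) (x m)]
  exact Finset.prod_congr rfl fun m _ => sum_fejer (hN m) _

theorem abs_prod_le_of_le_fejer
    (hg : ∀ m k t, |g m k t| ≤ C * fejer (N m) ((k : ℕ) / (N m : ℝ)) t) (k : Cell N) (x : Cube d) :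
    |∏ m, g m (k m) (x m)| ≤ C ^ d * ∏ m, fejer (N m) (((k m) : ℕ) / (N m : ℝ)) (x m) := by
  rw [Finset.abs_prod]
  refine (Finset.prod_le_prod (fun m _ => abs_nonneg _) fun m _ => hg m (k m) (x m)).trans ?_
  rw [Finset.prod_mul_distrib]
  simp

theorem abs_cellSum_le (hN : ∀ m, 0 < N m)
    (hg : ∀ m k t, |g m k t| ≤ C * fejer (N m) ((k : ℕ) / (N m : ℝ)) t) {a : Cell N → ℝ} {r : ℝ}
    (ha : ∀ k, |a k| ≤ r / cellCount N) (x : Cube d) : |cellSum g a x| ≤ C ^ d * r := by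
  have hK : 0 < cellCount N := Finset.prod_pos fun m _ => by exact_mod_cast hN m
  calc |cellSum g a x| ≤ ∑ k, |a k * ∏ m, g m (k m) (x m)| := Finset.abs_sum_le_sum_abs _ _
    _ ≤ ∑ k : Cell N, r / cellCount N *
        (C ^ d * ∏ m, fejer (N m) (((k m) : ℕ) / (N m : ℝ)) (x m)) := by
        refine Finset.sum_le_sum fun k _ => ?_
        rw [abs_mul]
        exact mul_le_mul (ha k) (abs_prod_le_of_le_fejer hg k x) (abs_nonneg _)
          ((abs_nonneg _).trans (ha k))
    _ = C ^ d * r := by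
        rw [← Finset.mul_sum, ← Finset.mul_sum, sum_prod_fejer hN]
        field_simp

theorem fourierCoeff_cellSum (hN : ∀ m, 0 < N m) (hg : ∀ m k, g m k ∈ trigPoly (4 * N m))
    (a : Cell N → ℝ) (j : Fin d → ℕ+) (hj : ∃ m, 9 * (N m : ℝ) < (j m : ℕ)) :
    fourierCoeff j (cellSum g a) = 0 := by
  have hgc : ∀ m k, Continuous (g m k) := fun m k => continuous_of_mem_trigPoly (hg m k)
  obtain ⟨m₀, hm₀⟩ := hj
  have hm₁ : 9 * N m₀ < (j m₀ : ℕ) := by exact_mod_cast hm₀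
  have hφ := fun j : Fin d → ℕ+ => continuous_fourierBasis j
  have hp : ∀ k : Cell N, Continuous fun x : Cube d => ∏ m, g m (k m) (x m) :=
    fun k => continuous_prod_cube fun m => hgc m (k m)
  unfold fourierCoeff cellSum
  simp_rw [Finset.sum_mul, mul_assoc]
  rw [integral_finsetSum _ fun k _ => integrable_cube
    (by have := hp k; have := hφ j; fun_prop)]
  refine Finset.sum_eq_zero fun k _ => ?_
  rw [integral_const_mul]
  unfold fourierBasis
  simp_rw [← Finset.prod_mul_distrib]
  rw [integral_prod_cube (fun m t => g m (k m) t * fourierOne (j m) t),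
    Finset.prod_eq_zero (Finset.mem_univ m₀), mul_zero]
  have := hN m₀
  exact integral_mul_fourierOne_eq_zero (hg m₀ (k m₀)) (by omega)

end CellSum

section Kernels

variable {d : ℕ} {N : Fin d → ℕ}

/-- The perturbation kernel of a cell of the cube. -/
noncomputable def cellBump (k : Cell N) (x : Cube d) : ℝ := ∏ m, bump (N m) (k m) (x m)

/-- The test kernel of a cell of the cube. -/
noncomputable def cellProbe (k : Cell N) (x : Cube d) : ℝ := ∏ m, probe (N m) (k m) (x m)

theorem continuous_cellBump (k : Cell N) : Continuous (cellBump k) :=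
  continuous_prod_cube fun m => continuous_bump (k m)

theorem continuous_cellProbe (k : Cell N) : Continuous (cellProbe k) :=
  continuous_prod_cube fun m => continuous_probe (k m)

theorem integral_cellBump_mul_cellProbe (hN : ∀ m, 0 < N m) (k l : Cell N) :
    ∫ x, cellBump k x * cellProbe l x = if k = l then cellCount N else 0 := by
  unfold cellBump cellProbe
  simp_rw [← Finset.prod_mul_distrib]
  rw [integral_prod_cube (fun m t => bump (N m) (k m) t * probe (N m) (l m) t)]
  simp_rw [integral_bump_mul_probe (hN _)]
  rw [Finset.prod_ite_zero]
  simp [funext_iff, cellCount]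

theorem integral_cellBump (hd : 0 < d) (hN : ∀ m, 0 < N m) (k : Cell N) :
    ∫ x, cellBump k x = 0 := by
  unfold cellBump
  rw [integral_prod_cube (fun m t => bump (N m) (k m) t),
    Finset.prod_eq_zero (Finset.mem_univ ⟨0, hd⟩) (integral_bump (hN _) _)]

/-- Each perturbation kernel has mass at most one, although its maximum is the number of cells. -/
theorem integral_abs_cellBump_le (hN : ∀ m, 0 < N m) (k : Cell N) :
    ∫ x, |cellBump k x| ≤ 1 := by
  have hc := continuous_cellBump k
  calc ∫ x, |cellBump k x|
      ≤ ∫ x : Cube d, ∏ m, fejer (N m) (((k m) : ℕ) / (N m : ℝ)) (x m) := by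
        refine integral_mono (integrable_cube (by fun_prop))
          (integrable_cube (continuous_prod_cube fun m => continuous_fejer _ _)) fun x => ?_
        have := abs_prod_le_of_le_fejer (g := fun m k => bump (N m) k) (C := 1)
          (fun m k t => by rw [one_mul]; exact abs_bump_le _ k t) k x
        simpa [cellBump] using this
    _ = 1 := by
        rw [integral_prod_cube (fun m t => fejer (N m) (((k m) : ℕ) / (N m : ℝ)) t)]
        simp [integral_fejer (hN _)]

/-- The perturbation of the uniform density with coefficients `a`. -/
noncomputable def perturbation (a : Cell N → ℝ) : Cube d → ℝ := cellSum (fun m => bump (N m)) a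

/-- The test function with coefficients `a`. -/
noncomputable def testFunction (a : Cell N → ℝ) : Cube d → ℝ := cellSum (fun m => probe (N m)) a

theorem perturbation_apply (a : Cell N → ℝ) (x : Cube d) :
    perturbation a x = ∑ k, a k * cellBump k x := rfl

theorem testFunction_apply (a : Cell N → ℝ) (x : Cube d) :
    testFunction a x = ∑ k, a k * cellProbe k x := rfl

theorem continuous_perturbation (a : Cell N → ℝ) : Continuous (perturbation a) :=
  continuous_cellSum (fun _ k => continuous_bump k) a

theorem continuous_testFunction (a : Cell N → ℝ) : Continuous (testFunction a) :=
  continuous_cellSum (fun _ k => continuous_probe k) a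

theorem abs_perturbation_le (hN : ∀ m, 0 < N m) {a : Cell N → ℝ} {r : ℝ}
    (ha : ∀ k, |a k| ≤ r / cellCount N) (x : Cube d) : |perturbation a x| ≤ r := by
  have := abs_cellSum_le (g := fun m => bump (N m)) (C := 1) hN
    (fun m k t => by rw [one_mul]; exact abs_bump_le _ k t) ha x
  simpa [perturbation] using this

theorem integral_perturbation (hd : 0 < d) (hN : ∀ m, 0 < N m) (a : Cell N → ℝ) :
    ∫ x, perturbation a x = 0 := by
  have hc := fun k : Cell N => continuous_cellBump k
  simp_rw [perturbation_apply]
  rw [integral_finsetSum _ fun k _ => integrable_cube (by fun_prop)]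
  simp [integral_const_mul, integral_cellBump hd hN]

theorem integral_perturbation_mul_cellProbe (hN : ∀ m, 0 < N m) (a : Cell N → ℝ) (k : Cell N) :
    ∫ x, perturbation a x * cellProbe k x = a k * cellCount N := by
  have hc := fun k : Cell N => continuous_cellBump k
  have hp := fun k : Cell N => continuous_cellProbe k
  simp_rw [perturbation_apply, Finset.sum_mul, mul_assoc]
  rw [integral_finsetSum _ fun k _ => integrable_cube (by fun_prop)]
  simp [integral_const_mul, integral_cellBump_mul_cellProbe hN]

theorem one_add_perturbation_mem (hd : 0 < d) (hN : ∀ m, 0 < N m) {β : Fin d → ℝ}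
    (hβ : ∀ m, 0 ≤ β m) {a : Cell N → ℝ} {r R : ℝ} (ha : ∀ k, |a k| ≤ r / cellCount N)
    (hR : boxWeight β (fun m => 9 * (N m : ℝ)) * r ^ 2 ≤ R ^ 2 - d) :
    (fun x => 1 + perturbation a x) ∈ sobolevBall β R :=
  one_add_mem_sobolevBall hβ (fun m => by positivity) (continuous_perturbation a)
    (abs_perturbation_le hN ha)
    (fun j hj => fourierCoeff_cellSum hN (fun _ k => bump_mem_trigPoly k) a j hj)
    (integral_perturbation hd hN a) hR

theorem testFunction_mem (hN : ∀ m, 0 < N m) {β : Fin d → ℝ}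
    (hβ : ∀ m, 0 ≤ β m) {a : Cell N → ℝ} {r R : ℝ} (ha : ∀ k, |a k| ≤ r / cellCount N)
    (hR : boxWeight β (fun m => 9 * (N m : ℝ)) * (6 ^ d * r) ^ 2 ≤ R ^ 2) :
    testFunction a ∈ sobolevBall β R :=
  mem_sobolevBall_of_band hβ (fun m => by positivity) (continuous_testFunction a)
    (fun x => abs_cellSum_le (g := fun m => probe (N m)) hN (fun m k t => abs_probe_le _ k t) ha x)
    (fun j hj => fourierCoeff_cellSum hN (fun _ k => probe_mem_trigPoly k) a j hj) hR

theorem isDensity_one_add_perturbation (hd : 0 < d) (hN : ∀ m, 0 < N m) {a : Cell N → ℝ}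
    (ha : ∀ k, |a k| ≤ 1 / cellCount N) : IsDensity fun x => 1 + perturbation a x where
  integrable := integrable_cube (continuous_const.add (continuous_perturbation a))
  nonneg := ae_of_all _ fun x => by
    have := (abs_le.1 (abs_perturbation_le hN ha x)).1
    simp only [Pi.zero_apply]
    linarith
  integral_eq_one := by
    rw [integral_add (integrable_const _) (integrable_cube (continuous_perturbation a)),
      integral_perturbation hd hN]
    simp

end Kernels

/-! ### Information bounds for locally private samples -/

/-- Two probability measures whose mutual density lies in `[1 - η, 1 + η]` have `χ²`-divergence at
most `η²`. The bound is stated in its dual form. -/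
theorem sq_lintegral_le_of_close {Z : Type*} [MeasurableSpace Z] {m m' : Measure Z}
    [IsProbabilityMeasure m] [IsProbabilityMeasure m'] {η : ℝ} (hη : 0 ≤ η)
    (h1 : ∀ B, MeasurableSet B → m B ≤ ENNReal.ofReal (1 + η) * m' B)
    (h2 : ∀ B, MeasurableSet B → m' B ≤ m B + ENNReal.ofReal η * m' B)
    {φ : Z → ℝ≥0∞} (hφ : Measurable φ) :
    (∫⁻ z, φ z ∂m) ^ 2 ≤ ENNReal.ofReal (1 + η ^ 2) * ∫⁻ z, φ z ^ 2 ∂m' := by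
  have hac : m ≪ m' := Measure.AbsolutelyContinuous.mk fun B hB h0 => by
    have := h1 B hB
    rw [h0, mul_zero] at this
    exact le_antisymm this zero_le
  set r := m.rnDeriv m' with hr
  have hrm : Measurable r := Measure.measurable_rnDeriv m m'
  have hrB : ∀ B, ∫⁻ z in B, r z ∂m' = m B := fun B => Measure.setLIntegral_rnDeriv hac B
  have hr1 : ∀ᵐ z ∂m', r z ≤ ENNReal.ofReal (1 + η) := by
    refine ae_le_of_forall_setLIntegral_le_of_sigmaFinite hrm fun B hB _ => ?_
    rw [hrB, setLIntegral_const]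
    exact h1 B hB
  have hr2 : ∀ᵐ z ∂m', 1 ≤ r z + ENNReal.ofReal η := by
    refine ae_le_of_forall_setLIntegral_le_of_sigmaFinite measurable_const fun B hB _ => ?_
    rw [lintegral_add_right _ measurable_const, hrB, setLIntegral_const, setLIntegral_const, one_mul]
    exact h2 B hB
  have hsq : ∀ᵐ z ∂m', r z ^ 2 + 1 ≤ ENNReal.ofReal (η ^ 2) + 2 * r z := by
    filter_upwards [hr1, hr2] with z hz1 hz2
    have hfin : r z ≠ ∞ := ne_top_of_le_ne_top ENNReal.ofReal_ne_top hz1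
    obtain ⟨s, hs⟩ : ∃ s : ℝ, r z = ENNReal.ofReal s ∧ 0 ≤ s :=
      ⟨(r z).toReal, (ENNReal.ofReal_toReal hfin).symm, ENNReal.toReal_nonneg⟩
    obtain ⟨hs, hs0⟩ := hs
    rw [hs] at hz1 hz2 ⊢
    rw [ENNReal.ofReal_le_ofReal_iff (by linarith)] at hz1
    rw [← ENNReal.ofReal_add hs0 hη, ← ENNReal.ofReal_one,
      ENNReal.ofReal_le_ofReal_iff (by linarith)] at hz2
    rw [← ENNReal.ofReal_pow hs0, ← ENNReal.ofReal_one, ← ENNReal.ofReal_add (by positivity) (by simp),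
      show (2 : ℝ≥0∞) = ENNReal.ofReal 2 by simp, ← ENNReal.ofReal_mul (by norm_num),
      ← ENNReal.ofReal_add (by positivity) (by positivity)]
    refine ENNReal.ofReal_le_ofReal ?_
    nlinarith
  have hr3 : ∫⁻ z, r z ^ 2 ∂m' ≤ ENNReal.ofReal (1 + η ^ 2) := by
    have hi := lintegral_mono_ae hsq
    rw [lintegral_add_right _ measurable_const, lintegral_add_left measurable_const,
      lintegral_const_mul _ hrm] at hi
    have hru : ∫⁻ z, r z ∂m' = 1 := by
      rw [← setLIntegral_univ, hrB, measure_univ]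
    rw [hru] at hi
    simp only [lintegral_const, measure_univ, mul_one] at hi
    rw [add_comm 1, ENNReal.ofReal_add (by positivity) (by norm_num), ENNReal.ofReal_one]
    have : (2 : ℝ≥0∞) = 1 + 1 := by norm_num
    rw [this, ← add_assoc] at hi
    exact (ENNReal.add_le_add_iff_right ENNReal.one_ne_top).1 hi
  have hmul : ∫⁻ z, φ z ∂m = ∫⁻ z, r z * φ z ∂m' := (lintegral_rnDeriv_mul hac hφ.aemeasurable).symm
  have hcs := ENNReal.lintegral_mul_le_Lp_mul_Lq m' Real.HolderConjugate.two_two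
    hrm.aemeasurable hφ.aemeasurable
  have hcs2 := pow_le_pow_left₀ zero_le hcs 2
  rw [mul_pow] at hcs2
  have hpow : ∀ a : ℝ≥0∞, (a ^ (1 / (2 : ℝ))) ^ 2 = a := fun a => by
    rw [← ENNReal.rpow_natCast, ← ENNReal.rpow_mul]; norm_num
  rw [hpow, hpow] at hcs2
  simp only [ENNReal.rpow_two, Pi.mul_apply] at hcs2
  rw [hmul]
  exact hcs2.trans (by gcongr)

section Channel

variable {X Z : Type*} [MeasurableSpace X] [MeasurableSpace Z]

/-- The effect of a private channel: private views of data with densities `f` and `f'` are closer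
than the data by a factor `e^α - 1`, uniformly over events. The point is that `x ↦ κ x B` deviates
from its mean by at most `(e^α - 1)` times that mean, and that constants integrate to zero against
`f - f'`. -/
theorem abs_integral_channel_sub_le {μ : Measure X} [IsFiniteMeasure μ] {f f' : X → ℝ}
    (hf : Integrable f μ) (hf' : Integrable f' μ) (hf0' : 0 ≤ᵐ[μ] f')
    (h1 : ∫ x, f x ∂μ = 1) (h1' : ∫ x, f' x ∂μ = 1)
    {u : X → ℝ} (hum : Measurable u) (hu0 : ∀ x, 0 ≤ u x) (hu1 : ∀ x, u x ≤ 1) {α : ℝ}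
    (hα : 0 ≤ α) (hu : ∀ x x', u x ≤ Real.exp α * u x') :
    |∫ x, f x * u x ∂μ - ∫ x, f' x * u x ∂μ|
      ≤ (Real.exp α - 1) * (∫ x, |f x - f' x| ∂μ) * ∫ x, f' x * u x ∂μ := by
  have hbd : ∀ᵐ x ∂μ, ‖u x‖ ≤ 1 := ae_of_all _ fun x => by
    rw [Real.norm_of_nonneg (hu0 x)]; exact hu1 x
  have hfu : Integrable (fun x => f x * u x) μ := hf.mul_bdd hum.aestronglyMeasurable hbd
  have hfu' : Integrable (fun x => f' x * u x) μ := hf'.mul_bdd hum.aestronglyMeasurable hbd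
  set i := ∫ x, f' x * u x ∂μ with hi
  have he1 : 1 ≤ Real.exp α := Real.one_le_exp hα
  have hlow : ∀ x, u x ≤ Real.exp α * i := by
    intro x
    have : ∫ y, f' y * u x ∂μ ≤ ∫ y, f' y * (Real.exp α * u y) ∂μ := by
      refine integral_mono_ae (hf'.mul_const _) ?_ ?_
      · simpa [mul_left_comm] using hfu'.const_mul (Real.exp α)
      · filter_upwards [hf0'] with y hy
        exact mul_le_mul_of_nonneg_left (hu x y) hy
    rw [integral_mul_const, h1', one_mul] at this
    simp_rw [mul_left_comm _ (Real.exp α)] at this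
    rwa [integral_const_mul] at this
  have hup : ∀ x, i ≤ Real.exp α * u x := by
    intro x
    have : ∫ y, f' y * u y ∂μ ≤ ∫ y, f' y * (Real.exp α * u x) ∂μ := by
      refine integral_mono_ae hfu' (hf'.mul_const _) ?_
      filter_upwards [hf0'] with y hy
      exact mul_le_mul_of_nonneg_left (hu y x) hy
    rwa [integral_mul_const, h1', one_mul] at this
  have hi0 : 0 ≤ i := integral_nonneg_of_ae (by
    filter_upwards [hf0'] with y hy; exact mul_nonneg hy (hu0 y))
  have hdev : ∀ x, |u x - i| ≤ (Real.exp α - 1) * i := by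
    intro x
    rw [abs_le]
    constructor
    · by_contra hcon
      push Not at hcon
      have h3 : u x < i := by nlinarith
      nlinarith [hup x, hu0 x]
    · linarith [hlow x]
  have hsub : ∫ x, f x * u x ∂μ - i = ∫ x, (f x - f' x) * (u x - i) ∂μ := by
    have : ∀ x, (f x - f' x) * (u x - i) = (f x * u x - f' x * u x) - (f x * i - f' x * i) :=
      fun x => by ring
    have hd1 : Integrable (fun x => f x * u x - f' x * u x) μ := hfu.sub hfu'
    have hd2 : Integrable (fun x => f x * i - f' x * i) μ := (hf.mul_const i).sub (hf'.mul_const i)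
    simp_rw [this]
    rw [integral_sub hd1 hd2, integral_sub hfu hfu', integral_sub (hf.mul_const _) (hf'.mul_const _),
      integral_mul_const, integral_mul_const, h1, h1']
    ring
  rw [hsub]
  have hab : Integrable (fun x => |f x - f' x|) μ := (hf.sub hf').abs
  rw [← Real.norm_eq_abs]
  calc ‖∫ x, (f x - f' x) * (u x - i) ∂μ‖
      ≤ ∫ x, |f x - f' x| * ((Real.exp α - 1) * i) ∂μ := by
        refine norm_integral_le_of_norm_le (hab.mul_const _) (ae_of_all _ fun x => ?_)
        rw [norm_mul]
        exact mul_le_mul_of_nonneg_left (hdev x) (norm_nonneg _)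
    _ = (Real.exp α - 1) * (∫ x, |f x - f' x| ∂μ) * i := by
        rw [integral_mul_const]; ring

theorem bind_withDensity_apply {μ : Measure X} {f : X → ℝ} (hf : Integrable f μ)
    (hf0 : 0 ≤ᵐ[μ] f) (κ : Kernel X Z) [IsMarkovKernel κ] {B : Set Z} (hB : MeasurableSet B) :
    (μ.withDensity fun x => ENNReal.ofReal (f x)).bind κ B
      = ENNReal.ofReal (∫ x, f x * (κ x).real B ∂μ) := by
  have hum : Measurable fun x => κ x B := κ.measurable_coe hB
  have hbd : ∀ᵐ x ∂μ, ‖(κ x).real B‖ ≤ 1 := ae_of_all _ fun x => by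
    rw [Real.norm_of_nonneg measureReal_nonneg]; exact measureReal_le_one
  have hmr : Measurable fun x => (κ x).real B := hum.ennreal_toReal
  rw [Measure.bind_apply hB κ.measurable.aemeasurable,
    lintegral_withDensity_eq_lintegral_mul₀ hf.aemeasurable.ennreal_ofReal hum.aemeasurable,
    ofReal_integral_eq_lintegral_ofReal (hf.mul_bdd hmr.aestronglyMeasurable hbd)]
  · refine lintegral_congr_ae ?_
    filter_upwards [hf0] with x hx
    rw [Pi.mul_apply, ENNReal.ofReal_mul hx, ofReal_measureReal]
  · filter_upwards [hf0] with x hx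
    exact mul_nonneg hx measureReal_nonneg

theorem sq_lintegral_bind_le {μ : Measure X} [IsFiniteMeasure μ] {f f' : X → ℝ}
    (hf : Integrable f μ) (hf' : Integrable f' μ) (hf0 : 0 ≤ᵐ[μ] f) (hf0' : 0 ≤ᵐ[μ] f')
    (h1 : ∫ x, f x ∂μ = 1) (h1' : ∫ x, f' x ∂μ = 1)
    (κ : Kernel X Z) [IsMarkovKernel κ] {α : ℝ} (hα : 0 ≤ α)
    (hκ : ∀ x x' B, MeasurableSet B → κ x B ≤ ENNReal.ofReal (Real.exp α) * κ x' B)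
    {φ : Z → ℝ≥0∞} (hφ : Measurable φ) :
    (∫⁻ z, φ z ∂(μ.withDensity fun x => ENNReal.ofReal (f x)).bind κ) ^ 2
      ≤ ENNReal.ofReal (1 + ((Real.exp α - 1) * ∫ x, |f x - f' x| ∂μ) ^ 2)
        * ∫⁻ z, φ z ^ 2 ∂(μ.withDensity fun x => ENNReal.ofReal (f' x)).bind κ := by
  have hprob : ∀ {g : X → ℝ}, Integrable g μ → 0 ≤ᵐ[μ] g → ∫ x, g x ∂μ = 1 →
      IsProbabilityMeasure ((μ.withDensity fun x => ENNReal.ofReal (g x)).bind κ) := by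
    intro g hg hg0 hg1
    constructor
    rw [bind_withDensity_apply hg hg0 κ MeasurableSet.univ]
    simp [hg1]
  have := hprob hf hf0 h1
  have := hprob hf' hf0' h1'
  have he1 : 1 ≤ Real.exp α := Real.one_le_exp hα
  have hL1 : 0 ≤ ∫ x, |f x - f' x| ∂μ := integral_nonneg fun x => abs_nonneg _
  have hη : 0 ≤ (Real.exp α - 1) * ∫ x, |f x - f' x| ∂μ := mul_nonneg (by linarith) hL1
  have hclose : ∀ B, MeasurableSet B →
      |∫ x, f x * (κ x).real B ∂μ - ∫ x, f' x * (κ x).real B ∂μ|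
      ≤ (Real.exp α - 1) * (∫ x, |f x - f' x| ∂μ) * ∫ x, f' x * (κ x).real B ∂μ := by
    intro B hB
    refine abs_integral_channel_sub_le hf hf' hf0' h1 h1'
      (κ.measurable_coe hB).ennreal_toReal (fun x => measureReal_nonneg)
      (fun x => measureReal_le_one) hα fun x x' => ?_
    have := ENNReal.toReal_mono (ENNReal.mul_ne_top ENNReal.ofReal_ne_top (measure_ne_top _ _))
      (hκ x x' B hB)
    rwa [ENNReal.toReal_mul, ENNReal.toReal_ofReal (Real.exp_pos _).le] at this
  have hnn : ∀ {g : X → ℝ}, 0 ≤ᵐ[μ] g → ∀ B, 0 ≤ ∫ x, g x * (κ x).real B ∂μ := by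
    intro g hg0 B
    refine integral_nonneg_of_ae ?_
    filter_upwards [hg0] with x hx
    exact mul_nonneg hx measureReal_nonneg
  refine sq_lintegral_le_of_close hη (fun B hB => ?_) (fun B hB => ?_) hφ
  · rw [bind_withDensity_apply hf hf0 κ hB, bind_withDensity_apply hf' hf0' κ hB,
      ← ENNReal.ofReal_mul (by linarith)]
    refine ENNReal.ofReal_le_ofReal ?_
    have := (abs_le.1 (hclose B hB)).2
    linarith
  · rw [bind_withDensity_apply hf hf0 κ hB, bind_withDensity_apply hf' hf0' κ hB,
      ← ENNReal.ofReal_mul hη, ← ENNReal.ofReal_add (hnn hf0 B) (mul_nonneg hη (hnn hf0' B))]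
    refine ENNReal.ofReal_le_ofReal ?_
    have := (abs_le.1 (hclose B hB)).1
    linarith

theorem measurable_snoc (n : ℕ) :
    Measurable fun p : (Fin n → Z) × Z => (Fin.snoc p.1 p.2 : Fin (n + 1) → Z) := by
  refine measurable_pi_iff.2 fun i => ?_
  refine Fin.lastCases ?_ (fun j => ?_) i
  · simpa using measurable_snd
  · simpa [Function.comp_def] using (measurable_pi_apply j).comp measurable_fst

theorem isProbabilityMeasure_privateLaw (P : Measure X) [IsProbabilityMeasure P] :
    ∀ {n : ℕ} (Q : Mechanism X Z n), IsProbabilityMeasure (privateLaw P Q)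
  | 0, _ => by unfold privateLaw; infer_instance
  | n + 1, Q => by
    have := isProbabilityMeasure_privateLaw P Q.init
    have := Q.markov (Fin.last n)
    unfold privateLaw
    refine Measure.isProbabilityMeasure_map ?_
    exact ((measurable_snoc n).comp
      ((measurable_snd.comp measurable_fst).prodMk measurable_snd)).aemeasurable

/-- The channel of the last individual, given the earlier private views. -/
noncomputable def lastChannel {n : ℕ} (Q : Mechanism X Z (n + 1)) (z : Fin n → Z) : Kernel X Z :=
  (Q.channel (Fin.last n)).comap (fun x => (x, z)) (by fun_prop)

theorem lintegral_privateLaw_succ (P : Measure X) [IsProbabilityMeasure P] {n : ℕ}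
    (Q : Mechanism X Z (n + 1)) {φ : (Fin (n + 1) → Z) → ℝ≥0∞} (hφ : Measurable φ) :
    Measurable (fun z : Fin n → Z => ∫⁻ w, φ (Fin.snoc z w) ∂P.bind (lastChannel Q z)) ∧
    ∫⁻ z, φ z ∂privateLaw P Q
      = ∫⁻ z, ∫⁻ w, φ (Fin.snoc z w) ∂P.bind (lastChannel Q z) ∂privateLaw P Q.init := by
  have := isProbabilityMeasure_privateLaw P Q.init
  have := Q.markov (Fin.last n)
  have hs : Measurable fun p : (X × (Fin n → Z)) × Z =>
      (Fin.snoc p.1.2 p.2 : Fin (n + 1) → Z) :=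
    (measurable_snoc n).comp ((measurable_snd.comp measurable_fst).prodMk measurable_snd)
  have hin : Measurable fun p : X × (Fin n → Z) =>
      ∫⁻ w, φ (Fin.snoc p.2 w) ∂Q.channel (Fin.last n) p :=
    Measurable.lintegral_kernel_prod_right' (hφ.comp hs)
  have hbind : ∀ z : Fin n → Z, ∫⁻ w, φ (Fin.snoc z w) ∂P.bind (lastChannel Q z)
      = ∫⁻ x, ∫⁻ w, φ (Fin.snoc z w) ∂Q.channel (Fin.last n) (x, z) ∂P := by
    intro z
    have hz : Measurable fun w : Z => φ (Fin.snoc z w) :=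
      hφ.comp ((measurable_snoc n).comp (measurable_const.prodMk measurable_id))
    rw [Measure.lintegral_bind (lastChannel Q z).measurable.aemeasurable hz.aemeasurable]
    rfl
  simp_rw [hbind]
  refine ⟨hin.lintegral_prod_left', ?_⟩
  have hφs : Measurable fun p : (X × (Fin n → Z)) × Z => φ (Fin.snoc p.1.2 p.2) := hφ.comp hs
  conv_lhs => unfold privateLaw
  rw [lintegral_map hφ hs, Measure.lintegral_compProd hφs,
    lintegral_prod_symm _ hin.aemeasurable]

end Channel

theorem isProbabilityMeasure_densityLaw {d : ℕ} {f : Cube d → ℝ} (hf : IsDensity f) :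
    IsProbabilityMeasure (densityLaw f) := by
  constructor
  rw [densityLaw, withDensity_apply _ MeasurableSet.univ, setLIntegral_univ,
    ← ofReal_integral_eq_lintegral_ofReal hf.integrable hf.nonneg, hf.integral_eq_one,
    ENNReal.ofReal_one]

theorem init_mem_ldpMechanisms {X Z : Type*} [MeasurableSpace X] [MeasurableSpace Z] {n : ℕ}
    {α : ℝ} {Q : Mechanism X Z (n + 1)} (hQ : Q ∈ ldpMechanisms X Z (n + 1) α) :
    Q.init ∈ ldpMechanisms X Z n α :=
  fun i z x x' B hB => hQ i.castSucc z x x' B hB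

/-- The `χ²`-divergence of the laws of the whole privatized sample tensorizes, in dual form. -/
theorem sq_lintegral_privateLaw_le {d : ℕ} {Z : Type*} [MeasurableSpace Z] {f f' : Cube d → ℝ}
    (hf : IsDensity f) (hf' : IsDensity f') {α : ℝ} (hα : 0 ≤ α) :
    ∀ {n : ℕ} {Q : Mechanism (Cube d) Z n}, Q ∈ ldpMechanisms (Cube d) Z n α →
      ∀ {φ : (Fin n → Z) → ℝ≥0∞}, Measurable φ →
      (∫⁻ z, φ z ∂privateLaw (densityLaw f) Q) ^ 2
        ≤ ENNReal.ofReal (1 + ((Real.exp α - 1) * ∫ x, |f x - f' x|) ^ 2) ^ n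
          * ∫⁻ z, φ z ^ 2 ∂privateLaw (densityLaw f') Q
  | 0, Q, _, φ, hφ => by
    unfold privateLaw
    rw [lintegral_dirac' _ hφ, lintegral_dirac' _ (hφ.pow_const 2)]
    simp
  | n + 1, Q, hQ, φ, hφ => by
    have := isProbabilityMeasure_densityLaw hf
    have := isProbabilityMeasure_densityLaw hf'
    have := Q.markov (Fin.last n)
    have : ∀ z, IsMarkovKernel (lastChannel Q z) := fun z => by unfold lastChannel; infer_instance
    obtain ⟨hm, he⟩ := lintegral_privateLaw_succ (densityLaw f) Q hφ
    obtain ⟨hm', he'⟩ := lintegral_privateLaw_succ (densityLaw f') Q (hφ.pow_const 2)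
    rw [he, he']
    refine (sq_lintegral_privateLaw_le hf hf' hα (init_mem_ldpMechanisms hQ) hm).trans ?_
    rw [pow_succ (ENNReal.ofReal _) n, mul_assoc, ← lintegral_const_mul _ hm']
    gcongr with z
    exact sq_lintegral_bind_le hf.integrable hf'.integrable hf.nonneg hf'.nonneg
      hf.integral_eq_one hf'.integral_eq_one (lastChannel Q z) hα
      (fun x x' B hB => hQ (Fin.last n) z x x' B hB)
      (hφ.comp ((measurable_snoc n).comp (measurable_const.prodMk measurable_id)))

/-- If the divergence is small, no test distinguishes the two densities reliably. -/
theorem half_le_privateLaw_add {d : ℕ} {Z : Type*} [MeasurableSpace Z] {f f' : Cube d → ℝ}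
    (hf : IsDensity f) (hf' : IsDensity f') {α : ℝ} (hα : 0 ≤ α) {n : ℕ}
    {Q : Mechanism (Cube d) Z n} (hQ : Q ∈ ldpMechanisms (Cube d) Z n α)
    (hsmall : (n : ℝ) * ((Real.exp α - 1) * ∫ x, |f x - f' x|) ^ 2 ≤ 1 / 2)
    {S : Set (Fin n → Z)} (hS : MeasurableSet S) :
    ENNReal.ofReal (1 / 2)
      ≤ privateLaw (densityLaw f') Q S + privateLaw (densityLaw f) Q Sᶜ := by
  have := isProbabilityMeasure_densityLaw hf
  have := isProbabilityMeasure_densityLaw hf'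
  have := isProbabilityMeasure_privateLaw (densityLaw f) Q
  have := isProbabilityMeasure_privateLaw (densityLaw f') Q
  have h := sq_lintegral_privateLaw_le hf hf' hα hQ (φ := S.indicator 1)
    (measurable_one.indicator hS)
  have hsq : ∀ z, (S.indicator 1 z : ℝ≥0∞) ^ 2 = S.indicator 1 z := by
    intro z
    by_cases hz : z ∈ S <;> simp [hz]
  simp_rw [hsq] at h
  rw [lintegral_indicator_one hS, lintegral_indicator_one hS] at h
  set η := (Real.exp α - 1) * ∫ x, |f x - f' x|
  have hC : (1 + η ^ 2) ^ n ≤ 2 := by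
    have h1 : (1 + η ^ 2) ^ n ≤ Real.exp (1 / 2) := by
      calc (1 + η ^ 2) ^ n ≤ Real.exp (η ^ 2) ^ n := by
            gcongr
            linarith [Real.add_one_le_exp (η ^ 2)]
        _ = Real.exp (n * η ^ 2) := by rw [← Real.exp_nat_mul]
        _ ≤ Real.exp (1 / 2) := Real.exp_le_exp.2 hsmall
    have h2 : Real.exp (1 / 2) * Real.exp (1 / 2) = Real.exp 1 := by
      rw [← Real.exp_add]; norm_num
    have h3 := Real.exp_one_lt_d9
    have h4 := Real.exp_pos (1 / 2)
    nlinarith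
  have hr : (privateLaw (densityLaw f) Q).real S ^ 2
      ≤ 2 * (privateLaw (densityLaw f') Q).real S := by
    rw [← ENNReal.ofReal_pow (by positivity)] at h
    have h' := ENNReal.toReal_mono (ENNReal.mul_ne_top ENNReal.ofReal_ne_top (measure_ne_top _ _)) h
    rw [ENNReal.toReal_mul, ENNReal.toReal_pow, ENNReal.toReal_ofReal (by positivity)] at h'
    exact h'.trans (mul_le_mul_of_nonneg_right hC ENNReal.toReal_nonneg)
  have hcompl : (privateLaw (densityLaw f) Q).real Sᶜ
      = 1 - (privateLaw (densityLaw f) Q).real S := by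
    rw [measureReal_compl hS]; simp
  rw [← ofReal_measureReal, ← ofReal_measureReal,
    ← ENNReal.ofReal_add measureReal_nonneg measureReal_nonneg]
  refine ENNReal.ofReal_le_ofReal ?_
  rw [hcompl]
  -- with `p = P(S)` and `P'(S) ≥ p² / 2`, the sum of the errors is at least `p² / 2 + 1 - p ≥ 1 / 2`
  nlinarith [sq_nonneg ((privateLaw (densityLaw f) Q).real S - 1)]

/-! ### Assouad's lemma and the hypercube of densities -/

/-- The sign encoded by a boolean. -/
def boolSign (b : Bool) : ℝ := if b then 1 else -1

theorem abs_boolSign (b : Bool) : |boolSign b| = 1 := by cases b <;> simp [boolSign]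

/-- The vertex of the hypercube obtained by reversing the sign of cell `k`. -/
def flipAt {ι : Type*} [DecidableEq ι] (k : ι) (ν : ι → Bool) : ι → Bool :=
  Function.update ν k (!ν k)

theorem flipAt_involutive {ι : Type*} [DecidableEq ι] (k : ι) :
    Function.Involutive (flipAt k : (ι → Bool) → ι → Bool) := by
  intro ν
  simp [flipAt]

/-- **Assouad's lemma**: if neighbouring vertices of the hypercube cannot be told apart, the total
error of sign estimators, summed over vertices and coordinates, is a fixed fraction of its
maximum. `E k b` is the event that the sign of coordinate `k` is estimated as `b`. -/
theorem assouad {ι Ω : Type*} [Fintype ι] [DecidableEq ι] [MeasurableSpace Ω]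
    (P : (ι → Bool) → Measure Ω) (E : ι → Bool → Set Ω) (r : ℝ≥0∞)
    (h : ∀ ν k, 2 * r ≤ P ν (E k (!ν k)) + P (flipAt k ν) (E k (ν k))) :
    (Fintype.card (ι → Bool) : ℝ≥0∞) * (Fintype.card ι * r) ≤ ∑ ν, ∑ k, P ν (E k (!ν k)) := by
  rw [Finset.sum_comm]
  have hk : ∀ k, (Fintype.card (ι → Bool) : ℝ≥0∞) * r ≤ ∑ ν, P ν (E k (!ν k)) := by
    intro k
    have hflip : ∑ ν, P (flipAt k ν) (E k (ν k)) = ∑ ν, P ν (E k (!ν k)) := by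
      rw [← Equiv.sum_comp ((flipAt_involutive k).toPerm _) fun ν => P ν (E k (!ν k))]
      refine Finset.sum_congr rfl fun ν _ => ?_
      simp [flipAt]
    have h2 : ∑ _ν : ι → Bool, 2 * r ≤ 2 * ∑ ν, P ν (E k (!ν k)) := by
      rw [two_mul (∑ ν, P ν (E k (!ν k)))]
      nth_rewrite 2 [← hflip]
      rw [← Finset.sum_add_distrib]
      exact Finset.sum_le_sum fun ν _ => h ν k
    rw [Finset.sum_const, Finset.card_univ, nsmul_eq_mul, mul_left_comm] at h2
    exact (ENNReal.mul_le_mul_iff_right (by norm_num) (by norm_num)).1 h2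
  calc (Fintype.card (ι → Bool) : ℝ≥0∞) * (Fintype.card ι * r)
      = ∑ _k : ι, (Fintype.card (ι → Bool) : ℝ≥0∞) * r := by
        rw [Finset.sum_const, Finset.card_univ, nsmul_eq_mul]; ring
    _ ≤ _ := Finset.sum_le_sum fun k _ => hk k

section Hypercube

variable {d : ℕ} {N : Fin d → ℕ}

/-- The coefficients of amplitude `r / #cells` with the signs `ν`. -/
noncomputable def signed (r : ℝ) (ν : Cell N → Bool) (k : Cell N) : ℝ :=
  boolSign (ν k) * (r / cellCount N)

theorem cellCount_pos (hN : ∀ m, 0 < N m) : 0 < cellCount N :=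
  Finset.prod_pos fun m _ => by exact_mod_cast hN m

theorem abs_signed (hN : ∀ m, 0 < N m) {r : ℝ} (hr : 0 ≤ r) (ν : Cell N → Bool) (k : Cell N) :
    |signed r ν k| = r / cellCount N := by
  rw [signed, abs_mul, abs_boolSign, one_mul, abs_of_nonneg]
  exact div_nonneg hr (cellCount_pos hN).le

/-- The density attached to a vertex of the hypercube. -/
noncomputable def vertexDensity (γ : ℝ) (ν : Cell N → Bool) (x : Cube d) : ℝ :=
  1 + perturbation (signed γ ν) x

/-- The sign of cell `k` estimated from an estimate of the density. -/
noncomputable def guess (ftilde : Cube d → ℝ) (k : Cell N) : Bool :=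
  decide (0 ≤ ∫ x, (ftilde x - 1) * cellProbe k x)

theorem integral_abs_vertexDensity_sub_le (hN : ∀ m, 0 < N m) {γ : ℝ} (hγ : 0 ≤ γ)
    (ν : Cell N → Bool) (k : Cell N) :
    ∫ x, |vertexDensity γ ν x - vertexDensity γ (flipAt k ν) x| ≤ 2 * γ / cellCount N := by
  have hK := cellCount_pos hN
  have e : ∀ x, |vertexDensity γ ν x - vertexDensity γ (flipAt k ν) x|
      = 2 * γ / cellCount N * |cellBump k x| := by
    intro x
    have : vertexDensity γ ν x - vertexDensity γ (flipAt k ν) x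
        = 2 * signed γ ν k * cellBump k x := by
      unfold vertexDensity
      rw [perturbation_apply, perturbation_apply, add_sub_add_left_eq_sub,
        ← Finset.sum_sub_distrib, Finset.sum_eq_single k]
      · unfold signed flipAt
        cases hν : ν k <;> simp [boolSign] <;> ring
      · intro l _ hl
        simp [signed, flipAt, hl]
      · simp
    rw [this, abs_mul, abs_mul, abs_signed hN hγ]
    simp only [Nat.abs_ofNat]
    ring
  simp_rw [e]
  rw [integral_const_mul]
  exact mul_le_of_le_one_right (by positivity) (integral_abs_cellBump_le hN k)

/-- The adversarial loss dominates a multiple of the number of wrongly estimated signs: the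
adversary tests with the signs of the actual deviations. -/
theorem le_adversarialLoss (hN : ∀ m, 0 < N m) {γ ε : ℝ} (hε : 0 < ε)
    {G : Set (Cube d → ℝ)} (hG : ∀ μ : Cell N → Bool, testFunction (signed ε μ) ∈ G)
    (ftilde : Cube d → ℝ) (ν : Cell N → Bool) :
    ENNReal.ofReal (∑ k, if guess ftilde k = !ν k then ε * γ / cellCount N else 0)
      ≤ (adversarialLoss G ftilde (vertexDensity γ ν)).toENNReal := by
  have hK := cellCount_pos hN
  set Δ : Cube d → ℝ := fun x => ftilde x - vertexDensity γ ν x with hΔ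
  by_cases hint : ∀ μ : Cell N → Bool, Integrable fun x => Δ x * testFunction (signed ε μ) x
  swap
  · push Not at hint
    obtain ⟨μ, hμ⟩ := hint
    have htop : adversarialLoss G ftilde (vertexDensity γ ν) = ⊤ := by
      unfold adversarialLoss
      exact top_le_iff.1 (le_iSup₂_of_le _ (hG μ) (by rw [if_neg hμ]))
    rw [htop]
    exact le_top
  -- reversing one sign of a test function isolates a single cell
  have hcell : ∀ k : Cell N, Integrable fun x => Δ x * cellProbe k x := by
    intro k
    have h1 := ((hint ν).sub (hint (flipAt k ν))).const_mul (1 / (2 * signed ε ν k))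
    refine h1.congr (ae_of_all _ fun x => ?_)
    have hne : signed ε ν k ≠ 0 := by
      rw [← abs_pos, abs_signed hN hε.le]; positivity
    have : testFunction (signed ε ν) x - testFunction (signed ε (flipAt k ν)) x
        = 2 * signed ε ν k * cellProbe k x := by
      rw [testFunction_apply, testFunction_apply, ← Finset.sum_sub_distrib,
        Finset.sum_eq_single k]
      · unfold signed flipAt
        cases hν : ν k <;> simp [boolSign] <;> ring
      · intro l _ hl
        simp [signed, flipAt, hl]
      · simp
    simp only [Pi.sub_apply]
    rw [← mul_sub, this]
    field_simp
  set c : Cell N → ℝ := fun k => ∫ x, Δ x * cellProbe k x with hc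
  have hc_eq : ∀ k, ∫ x, (ftilde x - 1) * cellProbe k x = c k + boolSign (ν k) * γ := by
    intro k
    have hp : Integrable fun x => perturbation (signed γ ν) x * cellProbe k x :=
      integrable_cube ((continuous_perturbation _).mul (continuous_cellProbe k))
    have : ∀ x, (ftilde x - 1) * cellProbe k x
        = Δ x * cellProbe k x + perturbation (signed γ ν) x * cellProbe k x := by
      intro x; simp only [hΔ, vertexDensity]; ring
    simp_rw [this]
    rw [integral_add (hcell k) hp, integral_perturbation_mul_cellProbe hN]
    unfold signed
    field_simp
    rfl
  have hwrong : ∀ k, (if guess ftilde k = !ν k then ε * γ / cellCount N else 0)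
      ≤ ε / cellCount N * |c k| := by
    intro k
    split_ifs with hk
    · have : γ ≤ |c k| := by
        unfold guess at hk
        rw [hc_eq] at hk
        cases hν : ν k
        · simp only [hν, Bool.not_false, decide_eq_true_eq, boolSign, Bool.false_eq_true,
            if_false] at hk
          exact le_trans (by linarith) (le_abs_self _)
        · simp only [hν, Bool.not_true, decide_eq_false_iff_not, boolSign, if_true] at hk
          exact le_trans (by linarith) (neg_le_abs _)
      calc ε * γ / cellCount N = ε / cellCount N * γ := by ring
        _ ≤ _ := by gcongr
    · positivity
  set μ : Cell N → Bool := fun k => decide (0 ≤ c k) with hμ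
  have hval : ∫ x, Δ x * testFunction (signed ε μ) x = ∑ k, ε / cellCount N * |c k| := by
    simp_rw [testFunction_apply, Finset.mul_sum, mul_left_comm (Δ _)]
    rw [integral_finsetSum _ fun k _ => (hcell k).const_mul _]
    refine Finset.sum_congr rfl fun k _ => ?_
    rw [integral_const_mul]
    change signed ε μ k * c k = _
    unfold signed
    by_cases h0 : 0 ≤ c k
    · simp [hμ, h0, boolSign, abs_of_nonneg h0]
    · simp [hμ, h0, boolSign, abs_of_neg (not_le.1 h0)]
  have hle : ((∑ k, ε / cellCount N * |c k| : ℝ) : EReal)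
      ≤ adversarialLoss G ftilde (vertexDensity γ ν) := by
    unfold adversarialLoss
    exact le_iSup₂_of_le _ (hG μ) (by rw [if_pos (hint μ), hval])
  refine le_trans ?_ (EReal.toENNReal_le_toENNReal hle)
  rw [EReal.real_coe_toENNReal]
  exact ENNReal.ofReal_le_ofReal (Finset.sum_le_sum fun k _ => hwrong k)

theorem measurable_guess {Ω : Type*} [MeasurableSpace Ω] {fhat : Ω → Cube d → ℝ}
    (hf : Measurable (Function.uncurry fhat)) (k : Cell N) :
    Measurable fun z => guess (fhat z) k := by
  have hm : Measurable fun z => ∫ x, (fhat z x - 1) * cellProbe k x := by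
    have : Measurable (Function.uncurry fun z (x : Cube d) => (fhat z x - 1) * cellProbe k x) :=
      (hf.sub_const 1).mul ((continuous_cellProbe k).measurable.comp measurable_snd)
    exact this.stronglyMeasurable.integral_prod_right.measurable
  refine measurable_to_bool ?_
  have : (fun z => guess (fhat z) k) ⁻¹' {true}
      = {z | 0 ≤ ∫ x, (fhat z x - 1) * cellProbe k x} := by
    ext z; simp [guess]
  rw [this]
  exact measurableSet_le measurable_const hm

/-- The minimax lower bound from one hypercube of densities. The conditions say that the densities
and the test functions lie in their Sobolev balls and that the privatized samples of neighbouring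
densities are not distinguishable. -/
theorem le_minimaxRate_of_hypercube (hd : 0 < d) (hN : ∀ m, 0 < N m) {β δ : Fin d → ℝ}
    (hβ : ∀ m, 0 ≤ β m) (hδ : ∀ m, 0 ≤ δ m) {R S γ ε α : ℝ} {n : ℕ} (hγ : 0 ≤ γ) (hγ1 : γ ≤ 1)
    (hε : 0 < ε) (hα : 0 ≤ α)
    (hR : boxWeight β (fun m => 9 * (N m : ℝ)) * γ ^ 2 ≤ R ^ 2 - d)
    (hS : boxWeight δ (fun m => 9 * (N m : ℝ)) * (6 ^ d * ε) ^ 2 ≤ S ^ 2)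
    (hpriv : (n : ℝ) * ((Real.exp α - 1) * (2 * γ / cellCount N)) ^ 2 ≤ 1 / 2)
    (Z : Type*) [MeasurableSpace Z] :
    ENNReal.ofReal (ε * γ / 4)
      ≤ minimaxRate (sobolevBall β R) (sobolevBall δ S) (ldpMechanisms (Cube d) Z n α) := by
  have hK := cellCount_pos hN
  refine le_iInf₂ fun Q hQ => le_iInf₂ fun fhat hfhat => ?_
  have hdens : ∀ ν : Cell N → Bool, IsDensity (vertexDensity γ ν) := fun ν =>
    isDensity_one_add_perturbation hd hN fun k => by
      rw [abs_signed hN hγ]; gcongr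
  have hmem : ∀ ν : Cell N → Bool, vertexDensity γ ν ∈ sobolevBall β R := fun ν =>
    one_add_perturbation_mem hd hN hβ (fun k => (abs_signed hN hγ ν k).le) hR
  have htest : ∀ μ : Cell N → Bool, testFunction (signed ε μ) ∈ sobolevBall δ S := fun μ =>
    testFunction_mem hN hδ (fun k => (abs_signed hN hε.le μ k).le) hS
  set P : (Cell N → Bool) → Measure (Fin n → Z) := fun ν =>
    privateLaw (densityLaw (vertexDensity γ ν)) Q with hP
  set E : Cell N → Bool → Set (Fin n → Z) := fun k b => {z | guess (fhat z) k = b} with hE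
  have hEm : ∀ k b, MeasurableSet (E k b) := fun k b =>
    measurable_guess hfhat k (measurableSet_singleton b)
  have hcompl : ∀ k b, (E k b)ᶜ = E k (!b) := by
    intro k b
    ext z
    simp only [hE, Set.mem_compl_iff, Set.mem_ofPred_eq]
    cases b <;> simp
  have hhalf : ENNReal.ofReal (1 / 2) = 2 * ENNReal.ofReal (1 / 4) := by
    rw [show (2 : ℝ≥0∞) = ENNReal.ofReal 2 by simp, ← ENNReal.ofReal_mul (by norm_num)]
    norm_num
  have hass := assouad P E (ENNReal.ofReal (1 / 4)) (by
    intro ν k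
    rw [← hhalf, ← hcompl, add_comm]
    refine half_le_privateLaw_add (hdens ν) (hdens (flipAt k ν)) hα hQ ?_ (hEm k (ν k))
    refine le_trans ?_ hpriv
    have h1 : 1 ≤ Real.exp α := Real.one_le_exp hα
    have h2 := integral_abs_vertexDensity_sub_le hN hγ ν k
    have h3 : 0 ≤ ∫ x, |vertexDensity γ ν x - vertexDensity γ (flipAt k ν) x| :=
      integral_nonneg fun x => abs_nonneg _
    have h4 : 0 ≤ Real.exp α - 1 := by linarith
    gcongr)
  set M := ⨆ f ∈ {f | f ∈ sobolevBall β R ∧ IsDensity f},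
        ∫⁻ z, (adversarialLoss (sobolevBall δ S) (fhat z) f).toENNReal
          ∂(privateLaw (densityLaw f) Q) with hM
  have hν : ∀ ν, ENNReal.ofReal (ε * γ / cellCount N) * ∑ k, P ν (E k (!ν k)) ≤ M := by
    intro ν
    calc ENNReal.ofReal (ε * γ / cellCount N) * ∑ k, P ν (E k (!ν k))
        = ∫⁻ z, ∑ k, (E k (!ν k)).indicator
            (fun _ => ENNReal.ofReal (ε * γ / cellCount N)) z ∂P ν := by
          rw [lintegral_finsetSum _ fun k _ => measurable_const.indicator (hEm k _),
            Finset.mul_sum]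
          exact Finset.sum_congr rfl fun k _ => (lintegral_indicator_const (hEm k _) _).symm
      _ ≤ ∫⁻ z, (adversarialLoss (sobolevBall δ S) (fhat z) (vertexDensity γ ν)).toENNReal
            ∂P ν := by
          refine lintegral_mono fun z => ?_
          refine le_trans (le_of_eq ?_) (le_adversarialLoss hN hε htest (fhat z) ν)
          rw [ENNReal.ofReal_sum_of_nonneg fun k _ => by positivity]
          refine Finset.sum_congr rfl fun k _ => ?_
          by_cases h : guess (fhat z) k = !ν k <;> simp [hE, h]
      _ ≤ M := le_iSup₂ (f := fun f (_ : f ∈ {f | f ∈ sobolevBall β R ∧ IsDensity f}) =>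
          ∫⁻ z, (adversarialLoss (sobolevBall δ S) (fhat z) f).toENNReal
          ∂(privateLaw (densityLaw f) Q)) (vertexDensity γ ν) ⟨hmem ν, hdens ν⟩
  have hsum : (Fintype.card (Cell N → Bool) : ℝ≥0∞) * ENNReal.ofReal (ε * γ / 4)
      ≤ (Fintype.card (Cell N → Bool) : ℝ≥0∞) * M := by
    have hcard : (Fintype.card (Cell N) : ℝ≥0∞) = ENNReal.ofReal (cellCount N) := by
      rw [Fintype.card_pi, cellCount, ← Nat.cast_prod, ENNReal.ofReal_natCast]
      simp
    calc (Fintype.card (Cell N → Bool) : ℝ≥0∞) * ENNReal.ofReal (ε * γ / 4)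
        = ENNReal.ofReal (ε * γ / cellCount N) * ((Fintype.card (Cell N → Bool) : ℝ≥0∞) *
          (Fintype.card (Cell N) * ENNReal.ofReal (1 / 4))) := by
          rw [mul_left_comm, hcard, ← ENNReal.ofReal_mul hK.le,
            ← ENNReal.ofReal_mul (by positivity)]
          congr 2
          field_simp
      _ ≤ ENNReal.ofReal (ε * γ / cellCount N) * ∑ ν, ∑ k, P ν (E k (!ν k)) := by gcongr
      _ ≤ ∑ _ν : Cell N → Bool, M := by
          rw [Finset.mul_sum]; exact Finset.sum_le_sum fun ν _ => hν ν
      _ = _ := by rw [Finset.sum_const, Finset.card_univ, nsmul_eq_mul]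
  exact (ENNReal.mul_le_mul_iff_right (by exact_mod_cast Fintype.card_ne_zero)
    (ENNReal.natCast_ne_top _)).1 hsum

end Hypercube

/-! ### Choice of the scale -/

theorem dim_div_harmonicMean {d : ℕ} (hd : 0 < d) (β : Fin d → ℝ) :
    (d : ℝ) / harmonicMean β = ∑ m, 1 / β m := by
  have : (d : ℝ) ≠ 0 := by positivity
  unfold harmonicMean
  field_simp

theorem harmonicMean_pos {d : ℕ} (hd : 0 < d) {β : Fin d → ℝ} (hβ : ∀ m, 0 < β m) :
    0 < harmonicMean β := by
  have hne : (Finset.univ : Finset (Fin d)).Nonempty := ⟨⟨0, hd⟩, Finset.mem_univ _⟩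
  have : 0 < ∑ m, 1 / β m := Finset.sum_pos (fun m _ => one_div_pos.2 (hβ m)) hne
  unfold harmonicMean
  positivity

theorem SameAnisotropy.eq_mul {d : ℕ} (hd : 0 < d) {β δ : Fin d → ℝ} (hβ : ∀ m, 0 < β m)
    (hδ : ∀ m, 0 < δ m) (h : SameAnisotropy β δ) (m : Fin d) :
    δ m = harmonicMean δ / harmonicMean β * β m := by
  have h1 := h m
  have h2 := harmonicMean_pos hd hβ
  have h3 := hβ m
  have h4 := hδ m
  field_simp at h1 ⊢
  linarith

/-- The box weight scales like `M ^ (2q)` when the side of the box in direction `m` is of order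
`M ^ (1 / β m)` and the exponents are `q * β m`. -/
theorem boxWeight_le_scale {d : ℕ} {β δ : Fin d → ℝ} (hβ : ∀ m, 0 < β m) (hδ : ∀ m, 0 ≤ δ m)
    {q : ℝ} (hq : ∀ m, δ m = q * β m) {M : ℝ} (hM : 0 < M) {D : Fin d → ℝ} (hD0 : ∀ m, 0 ≤ D m)
    (hD : ∀ m, D m ≤ 18 * M ^ (1 / β m)) :
    boxWeight δ D ≤ boxWeight δ (fun _ => 18) * (M ^ q) ^ 2 := by
  unfold boxWeight
  rw [Finset.sum_mul]
  refine Finset.sum_le_sum fun m _ => ?_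
  have h2 : 0 ≤ 2 * δ m := by have := hδ m; positivity
  calc D m ^ (2 * δ m) ≤ (18 * M ^ (1 / β m)) ^ (2 * δ m) := Real.rpow_le_rpow (hD0 m) (hD m) h2
    _ = 18 ^ (2 * δ m) * (M ^ q) ^ 2 := by
        rw [Real.mul_rpow (by norm_num) (Real.rpow_nonneg hM.le _), ← Real.rpow_mul hM.le,
          ← Real.rpow_natCast (M ^ q), ← Real.rpow_mul hM.le, hq m]
        congr 2
        have := (hβ m).ne'
        push_cast
        field_simp

theorem exp_sub_one_le {α A : ℝ} (hα : 0 ≤ α) (hαA : α ≤ A) :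
    Real.exp α - 1 ≤ α * Real.exp A := by
  have h1 : 1 - α ≤ Real.exp (-α) := by linarith [Real.add_one_le_exp (-α)]
  have h2 : Real.exp (-α) * Real.exp α = 1 := by rw [← Real.exp_add]; simp
  have h3 : Real.exp α - 1 ≤ α * Real.exp α := by
    have := mul_le_mul_of_nonneg_right h1 (Real.exp_pos α).le
    rw [h2] at this
    linarith
  exact h3.trans (mul_le_mul_of_nonneg_left (Real.exp_le_exp.2 hαA) hα)

/-- The lower bound at scale `M`: the grid has about `M ^ (1 / β m)` cells in direction `m`, the
densities deviate from the uniform one by a multiple of `s`, the test functions have size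
`M ^ (-q)`. -/
theorem exists_le_minimaxRate_of_scale {d : ℕ} (hd : 0 < d) {β δ : Fin d → ℝ}
    (hβ : ∀ m, 0 < β m) (hδ : ∀ m, 0 < δ m) {q : ℝ} (hq : ∀ m, δ m = q * β m) {R : ℝ}
    (hRd : (d : ℝ) < R ^ 2) (A : ℝ) :
    ∃ c : ℝ, 0 < c ∧ ∀ (n : ℕ) (α : ℝ), 0 < α → α ≤ A → ∀ M s : ℝ, 1 ≤ M → 0 < s → s * M ≤ 1 →
      (n : ℝ) * α ^ 2 * s ^ 2 ≤ (M ^ (∑ m, 1 / β m)) ^ 2 →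
        ∀ (Z : Type*) [MeasurableSpace Z], ENNReal.ofReal (c * (s / M ^ q))
          ≤ minimaxRate (sobolevBall β R) (sobolevBall δ 1) (ldpMechanisms (Cube d) Z n α) := by
  have hsmall : ∀ L : ℝ, 0 < L → ∃ c : ℝ, 0 < c ∧ c ^ 2 * L = 1 := fun L hL =>
    ⟨(Real.sqrt L)⁻¹, by positivity, by
      rw [inv_pow, Real.sq_sqrt hL.le, inv_mul_cancel₀ hL.ne']⟩
  have hWβ : 0 ≤ boxWeight β (fun _ => (18 : ℝ)) := boxWeight_nonneg β fun _ => by norm_num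
  have hWδ : 0 ≤ boxWeight δ (fun _ => (18 : ℝ)) := boxWeight_nonneg δ fun _ => by norm_num
  have hRd' : 0 < R ^ 2 - d := by linarith
  obtain ⟨c₁, hc₁, hc₁L⟩ := hsmall
    (boxWeight β (fun _ => 18) / (R ^ 2 - d) + 8 * Real.exp A ^ 2 + 1) (by positivity)
  obtain ⟨c₂, hc₂, hc₂L⟩ := hsmall (boxWeight δ (fun _ => 18) * (6 ^ d) ^ 2 + 1) (by positivity)
  have hc₁' : c₁ ≤ 1 := by
    have h1 : 0 ≤ c₁ ^ 2 * (boxWeight β (fun _ => 18) / (R ^ 2 - d)) := by positivity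
    have h2 : 0 ≤ c₁ ^ 2 * (8 * Real.exp A ^ 2) := by positivity
    nlinarith
  have hc₁A : c₁ ^ 2 * (8 * Real.exp A ^ 2) ≤ 1 := by
    have h1 : 0 ≤ c₁ ^ 2 * (boxWeight β (fun _ => 18) / (R ^ 2 - d)) := by positivity
    nlinarith [sq_nonneg c₁]
  have hc₁R : c₁ ^ 2 * boxWeight β (fun _ => 18) ≤ R ^ 2 - d := by
    have h1 : c₁ ^ 2 * (boxWeight β (fun _ => 18) / (R ^ 2 - d)) ≤ 1 := by
      nlinarith [sq_nonneg c₁, sq_nonneg (c₁ * Real.exp A)]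
    rw [← mul_div_assoc, div_le_one hRd'] at h1
    exact h1
  refine ⟨c₁ * c₂ / 4, by positivity, fun n α hα hαA M s hM hs hsM hpriv Z _ => ?_⟩
  have hM0 : 0 < M := by linarith
  have hroot : ∀ m, 1 ≤ M ^ (1 / β m) := fun m =>
    Real.one_le_rpow hM (one_div_nonneg.2 (hβ m).le)
  set N : Fin d → ℕ := fun m => ⌈M ^ (1 / β m)⌉₊ with hNdef
  have hN : ∀ m, 0 < N m := fun m => Nat.ceil_pos.2 (by linarith [hroot m])
  have hNup : ∀ m, 9 * (N m : ℝ) ≤ 18 * M ^ (1 / β m) := fun m => by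
    have := Nat.ceil_lt_add_one (by linarith [hroot m] : 0 ≤ M ^ (1 / β m))
    have := hroot m
    simp only [hNdef]
    linarith
  have hK : M ^ (∑ m, 1 / β m) ≤ cellCount N := by
    rw [Real.rpow_sum_of_pos hM0]
    exact Finset.prod_le_prod (fun m _ => by linarith [hroot m]) fun m _ => Nat.le_ceil _
  have hK0 := cellCount_pos hN
  have hMq : 0 < M ^ q := Real.rpow_pos_of_pos hM0 q
  have hs1 : s ≤ 1 := by nlinarith
  have hbound := le_minimaxRate_of_hypercube (α := α) (n := n) (R := R) (S := 1) (γ := c₁ * s)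
    (ε := c₂ / M ^ q) hd hN (fun m => (hβ m).le) (fun m => (hδ m).le) (by positivity)
    (mul_le_one₀ hc₁' hs.le hs1) (by positivity) hα.le ?_ ?_ ?_ Z
  · refine le_trans (ENNReal.ofReal_le_ofReal (le_of_eq ?_)) hbound
    field_simp
  · have hw := boxWeight_le_scale hβ (fun m => (hβ m).le) (q := 1) (by simp) hM0
      (D := fun m => 9 * (N m : ℝ)) (fun m => by positivity) hNup
    rw [Real.rpow_one] at hw
    calc boxWeight β (fun m => 9 * (N m : ℝ)) * (c₁ * s) ^ 2
        ≤ boxWeight β (fun _ => 18) * M ^ 2 * (c₁ * s) ^ 2 := by gcongr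
      _ = c₁ ^ 2 * boxWeight β (fun _ => 18) * (s * M) ^ 2 := by ring
      _ ≤ c₁ ^ 2 * boxWeight β (fun _ => 18) * 1 ^ 2 := by gcongr
      _ ≤ R ^ 2 - d := by rw [one_pow, mul_one]; exact hc₁R
  · have hw := boxWeight_le_scale hβ (fun m => (hδ m).le) hq hM0
      (D := fun m => 9 * (N m : ℝ)) (fun m => by positivity) hNup
    calc boxWeight δ (fun m => 9 * (N m : ℝ)) * (6 ^ d * (c₂ / M ^ q)) ^ 2
        ≤ boxWeight δ (fun _ => 18) * (M ^ q) ^ 2 * (6 ^ d * (c₂ / M ^ q)) ^ 2 := by gcongr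
      _ = c₂ ^ 2 * (boxWeight δ (fun _ => 18) * (6 ^ d) ^ 2) := by field_simp
      _ ≤ 1 ^ 2 := by nlinarith [sq_nonneg c₂]
  · have he := exp_sub_one_le hα.le hαA
    have he0 : 0 ≤ Real.exp α - 1 := by linarith [Real.one_le_exp hα.le]
    calc (n : ℝ) * ((Real.exp α - 1) * (2 * (c₁ * s) / cellCount N)) ^ 2
        ≤ (n : ℝ) * (α * Real.exp A * (2 * (c₁ * s) / cellCount N)) ^ 2 := by gcongr
      _ = c₁ ^ 2 * (8 * Real.exp A ^ 2) / 2 * ((n : ℝ) * α ^ 2 * s ^ 2 / cellCount N ^ 2) := by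
          field_simp; ring
      _ ≤ 1 / 2 * 1 := by
          gcongr
          rw [div_le_one (by positivity)]
          refine hpriv.trans ?_
          gcongr
      _ = 1 / 2 := mul_one _

end PrivateDensity

theorem theorem4 (d : ℕ) (hd : 0 < d) (β δ : Fin d → ℕ)
    (hβ : ∀ m, 0 < β m) (hδ : ∀ m, 0 < δ m)
    (hani : SameAnisotropy (fun m => (β m : ℝ)) (fun m => (δ m : ℝ)))
    (R : ℝ) (hR : 0 < R) (hRd : (d : ℝ) < R ^ 2) (A : ℝ) :
    ∃ c : ℝ, 0 < c ∧
      ∀ (n : ℕ) (α : ℝ), 0 < α → α ≤ A → 1 ≤ (n : ℝ) * α ^ 2 →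
        ∀ (Z : Type*) [MeasurableSpace Z],
          ENNReal.ofReal
              (c * max
                (((n : ℝ) * α ^ 2) ^
                  (-((harmonicMean (fun m => (β m : ℝ)) + harmonicMean (fun m => (δ m : ℝ))) /
                    (2 * harmonicMean (fun m => (β m : ℝ)) + 2 * (d : ℝ)))))
                (((n : ℝ) * α ^ 2) ^ (-(1 / 2 : ℝ))))
            ≤ minimaxRate
                (sobolevBall (fun m => (β m : ℝ)) R)
                (sobolevBall (fun m => (δ m : ℝ)) 1)
                (ldpMechanisms (Cube d) Z n α) := by
  have hβ' : ∀ m, (0 : ℝ) < (β m : ℝ) := fun m => by exact_mod_cast hβ m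
  have hδ' : ∀ m, (0 : ℝ) < (δ m : ℝ) := fun m => by exact_mod_cast hδ m
  obtain ⟨c, hc, hmain⟩ := exists_le_minimaxRate_of_scale hd hβ' hδ'
    (SameAnisotropy.eq_mul hd hβ' hδ' hani) hRd A
  refine ⟨c, hc, fun n α hα hαA hT Z _ => ?_⟩
  rw [← dim_div_harmonicMean hd] at hmain
  have hb := harmonicMean_pos hd hβ'
  set b := harmonicMean fun m => (β m : ℝ)
  set D := harmonicMean fun m => (δ m : ℝ)
  set T := (n : ℝ) * α ^ 2 with hTdef
  have hT0 : 0 < T := by linarith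
  have hd' : (0 : ℝ) < d := by exact_mod_cast hd
  rcases max_choice (T ^ (-((b + D) / (2 * b + 2 * (d : ℝ))))) (T ^ (-(1 / 2 : ℝ))) with h | h
  · rw [h]
    set M := T ^ (b / (2 * b + 2 * d)) with hM
    have hM1 : 1 ≤ M := Real.one_le_rpow hT (by positivity)
    have hM0 : 0 < M := by linarith
    refine le_trans (ENNReal.ofReal_le_ofReal (le_of_eq ?_))
      (hmain n α hα hαA M M⁻¹ hM1 (by positivity) (inv_mul_cancel₀ hM0.ne').le ?_ Z)
    · congr 1
      rw [← Real.rpow_neg_one, ← Real.rpow_sub hM0, hM,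
        ← Real.rpow_mul hT0.le]
      congr 1
      field_simp
      ring
    · -- at this scale the information bound holds with equality
      have h1 : M ^ 2 * (M ^ ((d : ℝ) / b)) ^ 2 = T := by
        rw [← Real.rpow_natCast, ← Real.rpow_natCast, ← Real.rpow_mul hM0.le,
          ← Real.rpow_add hM0, hM, ← Real.rpow_mul hT0.le]
        nth_rewrite 2 [← Real.rpow_one T]
        congr 1
        push_cast
        field_simp
      rw [← hTdef, ← h1]
      exact le_of_eq (by field_simp)
  · rw [h]
    have hs : 0 < T ^ (-(1 / 2 : ℝ)) := Real.rpow_pos_of_pos hT0 _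
    have hs2 : T * (T ^ (-(1 / 2 : ℝ))) ^ 2 = 1 := by
      rw [← Real.rpow_natCast, ← Real.rpow_mul hT0.le]
      norm_num
      rw [Real.rpow_neg_one, mul_inv_cancel₀ hT0.ne']
    refine le_trans (ENNReal.ofReal_le_ofReal (le_of_eq ?_))
      (hmain n α hα hαA 1 (T ^ (-(1 / 2 : ℝ))) le_rfl hs ?_ ?_ Z)
    · rw [Real.one_rpow, div_one]
    · rw [mul_one]
      exact Real.rpow_le_one_of_one_le_of_nonpos hT (by norm_num)
    · rw [Real.one_rpow, one_pow, ← hTdef, hs2]
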